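/- **Setting.** Let $X=(X^1,\dots,X^p)$ be a centred random element of $(L^2[0,1])^p$ with $E\|X^i\|^2<\infty$, and let $X_1,\dots,X_n$ ($n\ge 1$) be independent copies of $X$. Let the covariance operator of $X^i$ have the spectral decomposition $\Sigma^i=\sum_{r\ge1}\lambda^i_r\,\phi^i_r\otimes\phi^i_r$ with orthonormal eigenfunctions and $\lambda^i_1\ge\lambda^i_2\ge\cdots$, and let $\hat\Sigma^i f=\frac1n\sum_{u=1}^n\langle X^i_u,f\rangle X^i_u$. For $r\le m$ let $(\hat\lambda^i_r,\hat\phi^i_r)$ be the $m$ leading eigenpairs of $\hat\Sigma^i$ (orthonormal eigenfunctions, decreasing eigenvalues), with signs chosen so that $\langle\hat\phi^i_r,\phi^i_r\rangle\ge0$. The true and the estimated scores are $$\xi^i_{ur}=(\lambda^i_r)^{-1/2}\langle X^i_u,\phi^i_r\rangle,\qquad \hat\xi^i_{ur}=(\hat\lambda^i_r)^{-1/2}\langle X^i_u,\hat\phi^i_r\rangle$$ (with $\hat\xi^i_{ur}=0$ if $\hat\lambda^i_r=0$). The true scores are bounded, $|\xi^i_{ur}|\le M$ almost surely for all $i,u,r$,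 and $\Psi:\mathbb R\to[-1,1]$ is a monotone, $\Lambda$-Lipschitz transformation (for instance, if $M=1$, the projection of $\mathbb R$ onto $[-1,1]$, which leaves the true scores unchanged). Let $h_1,\dots,h_{k_n}$, $k_n=L_n+\ell+1$, be the normalized B-splines of degree $\ell\ge1$ on $[-1,1]$ with $L_n\ge 0$ equidistant interior knots, and for points $x_1,\dots,x_n\in\mathbb R$ put $$\tilde h_{nk}(x_u)=h_k(\Psi(x_u))-\frac1n\sum_{v=1}^n h_k(\Psi(x_v)).$$ **Assumptions.** There are constants $d_0,d_1,d_2,A,B>0$, $\beta>1$, $0\le\alpha<\frac1{2+3\beta}$ and $C$ such that 1. $d_0r^{-\beta}\le\lambda^i_r\le d_1r^{-\beta}$ and $\lambda^i_r-\lambda^i_{r+1}\ge d_2^{-1}r^{-1-\beta}$ for all $i$ and all $r\ge1$; 2. $A n^\alpha\le m\le B n^\alpha$, where $m=m_n$ is the number of scores; 3. the eigenfunctions $\phi^i_r$ are continuous and $|\phi^i_r(s)|\le C$ for all $i$, $r$ and all $s\in[0,1]$. **Theorem.** There are constants $C_1,K>0$, depending only on $d_0,d_1,d_2,\alpha,\beta,A,B,C,M,\Lambda,\ell$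 (and not on $n$, $p$, $m$, $L_n$, $\Psi$ or the law of $X$), such that for all $0<\delta\le C_1$, all $i,j\in\{1,\dots,p\}$, all $r,q\in\{1,\dots,m\}$ and all $k,l\in\{1,\dots,k_n\}$, $$P\Big(\Big|\frac1n\sum_{u=1}^n\big(\tilde h_{nk}(\hat\xi^i_{ur})\,\tilde h_{nl}(\hat\xi^j_{uq})-\tilde h_{nk}(\xi^i_{ur})\,\tilde h_{nl}(\xi^j_{uq})\big)\Big|\ge\delta\Big)\le K\exp\!\big(-C_1\,n^{1-\alpha(2+3\beta)}\,k_n^{-2}\,\delta^2\big).$$ -/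

import Mathlib

open MeasureTheory ProbabilityTheory
open scoped NNReal ENNReal unitInterval

namespace FPCA

/-- The Hilbert space of square-integrable real functions on `[0,1]` with Lebesgue measure. -/
abbrev L2I : Type := Lp ℝ 2 (volume : Measure I)

/-- The Hilbert space of square-integrable functions carries its Borel sigma-algebra. -/
noncomputable instance instMeasurableSpaceL2I : MeasurableSpace L2I := borel L2I

instance instBorelSpaceL2I : BorelSpace L2I := ⟨rfl⟩

/-- The covariance operator `f ↦ E[⟨X, f⟩ X]` of a centred, square-integrable random element `X`;
it is the integral operator with kernel `σ(s,t) = E[X(s) X(t)]`. -/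
noncomputable def covOp {Ω : Type*} [MeasurableSpace Ω] (P : Measure Ω) (X : Ω → L2I) (f : L2I) :
    L2I :=
  ∫ ω, (inner ℝ (X ω) f) • X ω ∂P

/-- The empirical covariance operator `f ↦ n⁻¹ ∑ᵤ ⟨xᵤ, f⟩ xᵤ` of observations `x₁, …, xₙ`;
it is the integral operator with kernel `n⁻¹ ∑ᵤ xᵤ(s) xᵤ(t)`. -/
noncomputable def sampleCovOp {n : ℕ} (x : Fin n → L2I) (f : L2I) : L2I :=
  (n : ℝ)⁻¹ • ∑ u, (inner ℝ (x u) f) • x u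

/-- `T = ∑ᵣ λᵣ φᵣ ⊗ φᵣ` with `λ₁ ≥ λ₂ ≥ …` and orthonormal `φ₁, φ₂, …`.
The index `r : ℕ` stands for the `(r+1)`-st eigenpair. -/
structure IsSpectralDecomposition (T : L2I → L2I) (lam : ℕ → ℝ) (phi : ℕ → L2I) : Prop where
  antitone : Antitone lam
  orthonormal : Orthonormal ℝ phi
  hasSum : ∀ f, HasSum (fun r => (lam r * inner ℝ (phi r) f) • phi r) (T f)

/-- `(lam r, phi r)`, `r : Fin m`, are `m` leading eigenpairs of the operator `T`: the `phi r` are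
orthonormal eigenfunctions, their eigenvalues are in decreasing order, and the quadratic form of
`T` on the orthogonal complement of the `phi r` does not exceed any of these eigenvalues. -/
structure IsLeadingEigensystem (T : L2I → L2I) {m : ℕ} (lam : Fin m → ℝ) (phi : Fin m → L2I) :
    Prop where
  antitone : Antitone lam
  orthonormal : Orthonormal ℝ phi
  eigen : ∀ r, T (phi r) = lam r • phi r
  leading : ∀ v, (∀ r, inner ℝ (phi r) v = 0) → ∀ r, inner ℝ (T v) v ≤ lam r * ‖v‖ ^ 2

/-- The eigenvalue decay and eigenvalue gap conditions, and the continuity and uniform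
boundedness of the eigenfunctions (the index `r : ℕ` stands for the `(r+1)`-st eigenpair). -/
structure EigenCondition (d₀ d₁ d₂ β Cφ : ℝ) {p : ℕ} (lam : Fin p → ℕ → ℝ)
    (phi : Fin p → ℕ → L2I) : Prop where
  lower : ∀ i (r : ℕ), d₀ * ((r : ℝ) + 1) ^ (-β) ≤ lam i r
  upper : ∀ i (r : ℕ), lam i r ≤ d₁ * ((r : ℝ) + 1) ^ (-β)
  gap : ∀ i (r : ℕ), d₂⁻¹ * ((r : ℝ) + 1) ^ (-1 - β) ≤ lam i r - lam i (r + 1)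
  bounded : ∀ i r, ∃ g : C(I, ℝ), ContinuousMap.toLp (E := ℝ) 2 (volume : Measure I) ℝ g = phi i r ∧
    ∀ s, |g s| ≤ Cφ

/-- The functional principal component score `⟨x, φ⟩ / √λ` of a function `x` (it is `0` if
`λ = 0`). -/
noncomputable def score (lam : ℝ) (phi x : L2I) : ℝ := (√lam)⁻¹ * inner ℝ x phi

/-- The clamped knot sequence for splines of degree `ℓ` on the equidistant partition of `[-1,1]`
with `L` interior knots: `-1` for `i ≤ ℓ`, then `-1 + 2 b / (L+1)` for `i = ℓ + b`, `b ≤ L`, and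
`1` for `i ≥ ℓ + L + 1`. -/
noncomputable def knot (ℓ L i : ℕ) : ℝ := -1 + 2 * (min (i - ℓ) (L + 1) : ℕ) / ((L : ℝ) + 1)

/-- The `i`-th normalized B-spline of degree `d` on the knots `knot ℓ L`, by the Cox–de Boor
recursion (quotients with denominator zero are zero). The last subinterval of the partition is
closed on the right. -/
noncomputable def bsplineAux (ℓ L : ℕ) : ℕ → ℕ → ℝ → ℝ
  | 0, i, x =>
    open Classical in
    if (knot ℓ L i ≤ x ∧ x < knot ℓ L (i + 1)) ∨ (i = ℓ + L ∧ x = 1) then 1 else 0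
  | d + 1, i, x =>
    (x - knot ℓ L i) / (knot ℓ L (i + d + 1) - knot ℓ L i) * bsplineAux ℓ L d i x +
    (knot ℓ L (i + d + 2) - x) / (knot ℓ L (i + d + 2) - knot ℓ L (i + 1)) *
      bsplineAux ℓ L d (i + 1) x

/-- The normalized B-spline basis `h₁, …, h_{L+ℓ+1}` of the splines of degree `ℓ` on `[-1,1]` with
`L` equidistant interior knots. -/
noncomputable def bspline (ℓ L : ℕ) (k : Fin (L + ℓ + 1)) (x : ℝ) : ℝ := bsplineAux ℓ L ℓ k x

/-- The empirically centred spline `h_k(x_u) - n⁻¹ ∑ᵥ h_k(x_v)` at the points `x₁, …, xₙ`. -/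
noncomputable def centredSpline (ℓ L : ℕ) (k : Fin (L + ℓ + 1)) {n : ℕ} (x : Fin n → ℝ)
    (u : Fin n) : ℝ :=
  bspline ℓ L k (x u) - (n : ℝ)⁻¹ * ∑ v, bspline ℓ L k (x v)

/-- The entry with indices `((i,r,k), (j,q,l))` of the design matrix `n⁻¹ H Hᵀ` built from the
empirically centred B-splines; `z u i r` is the (transformed) `r`-th score of the `i`-th component
of the `u`-th observation. -/
noncomputable def designEntry (ℓ L : ℕ) {n p m : ℕ} (z : Fin n → Fin p → Fin m → ℝ)
    (i j : Fin p) (r q : Fin m) (k l : Fin (L + ℓ + 1)) : ℝ :=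
  (n : ℝ)⁻¹ * ∑ u, centredSpline ℓ L k (fun v => z v i r) u *
    centredSpline ℓ L l (fun v => z v j q) u

end FPCA

/-! All randomness is confined to one event per component: the sample covariance operator differs
from the covariance operator, as a bilinear form, by at most `t`. On this event the rest is
deterministic.

Splines of degree at least one are bounded and Lipschitz with constant of order `L + 1`, so a design
entry moves by at most a constant times `L + 1` times the mean absolute errors of the two scores
involved (`abs_designEntry_sub_le`). These errors are controlled by perturbation theory:
Courant–Fischer puts the sample eigenvalues within `t` of the true ones, the spectral gap turns this
into an eigenfunction error of order `t / gap`, and Cauchy–Schwarz averages over the sample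
(`mean_abs_score_sub_le`). Polynomial decay makes the score error of order `t * r ^ (1 + 3β/2)`,
hence of order `t * n ^ (α (1 + 3β/2))` for `r ≤ m`.

The exceptional event is controlled through the Hilbert–Schmidt norm, which dominates the form
bound. Bounded scores and summable eigenvalues bound the Hilbert–Schmidt norm of each centred
summand, so a dimension-free Hoeffding inequality applies to finitely many coordinates, and monotone
continuity of `P` removes the truncation (`measureReal_sampleCovOp_sub_le`). The probability is of
order `exp (-const * n t²)`; choosing `t` of order `δ / (kₙ n ^ (α (1 + 3β/2)))` gives the stated
rate. -/

namespace FPCA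

/-! ### A dimension-free Hoeffding inequality in Euclidean space. -/

lemma pow_add_pow_le_of_add_eq {X Y P Q : ℝ} (hQ : 0 ≤ Q) (hQX : Q ≤ X) (hXP : X ≤ P)
    (h : X + Y = P + Q) (k : ℕ) : X ^ k + Y ^ k ≤ P ^ k + Q ^ k := by
  rcases eq_or_lt_of_le (hQX.trans hXP) with hPQ | hPQ
  · have hX : X = P := by linarith
    have hY : Y = Q := by linarith
    rw [hX, hY]
  · have hc := convexOn_pow (𝕜 := ℝ) k
    set θ := (X - Q) / (P - Q) with hθ
    have hd : 0 < P - Q := by linarith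
    have h0 : 0 ≤ θ := div_nonneg (by linarith) hd.le
    have h1 : θ ≤ 1 := (div_le_one hd).2 (by linarith)
    have hX : X = θ * P + (1 - θ) * Q := by rw [hθ]; field_simp; ring
    have hY : Y = (1 - θ) * P + θ * Q := by linarith
    have e1 := hc.2 (Set.mem_Ici.2 (hQ.trans hPQ.le)) (Set.mem_Ici.2 hQ) h0
      (sub_nonneg.2 h1) (by ring)
    have e2 := hc.2 (Set.mem_Ici.2 (hQ.trans hPQ.le)) (Set.mem_Ici.2 hQ) (sub_nonneg.2 h1)
      h0 (by ring)
    simp only [smul_eq_mul] at e1 e2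
    rw [← hX] at e1
    rw [← hY] at e2
    linarith

/-- The power series of `cosh` has nonnegative coefficients in the square of its argument, so the
comparison follows term by term from convexity of powers on pairs of squares with equal sums. -/
lemma cosh_add_cosh_le {x y p q : ℝ} (hq : 0 ≤ q) (hqx : q ≤ x) (hxp : x ≤ p)
    (h : x ^ 2 + y ^ 2 = p ^ 2 + q ^ 2) :
    Real.cosh x + Real.cosh y ≤ Real.cosh p + Real.cosh q := by
  refine hasSum_le (fun k => ?_) ((Real.hasSum_cosh x).add (Real.hasSum_cosh y))
    ((Real.hasSum_cosh p).add (Real.hasSum_cosh q))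
  rw [← add_div, ← add_div]
  refine div_le_div_of_nonneg_right ?_ (Nat.cast_nonneg _)
  simp only [pow_mul]
  exact pow_add_pow_le_of_add_eq (by positivity) (by gcongr) (by gcongr; linarith) h k

section CoshNorm

variable {E : Type*} [NormedAddCommGroup E] [InnerProductSpace ℝ E]

/-- By the parallelogram law the squared norms have the same sum as in the collinear case, where
they are most spread out and the addition formulas give equality. -/
lemma cosh_norm_add_add_cosh_norm_sub_le (a b : E) :
    Real.cosh ‖a + b‖ + Real.cosh ‖a - b‖ ≤ 2 * Real.cosh ‖a‖ * Real.cosh ‖b‖ := by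
  have h : ‖a + b‖ ^ 2 + ‖a - b‖ ^ 2 = (‖a‖ + ‖b‖) ^ 2 + |‖a‖ - ‖b‖| ^ 2 := by
    have := parallelogram_law_with_norm ℝ a b
    rw [sq_abs]; nlinarith
  have h1 : |‖a‖ - ‖b‖| ≤ ‖a + b‖ := by
    simpa using abs_norm_sub_norm_le a (-b)
  refine (cosh_add_cosh_le (abs_nonneg _) h1 (norm_add_le a b) h).trans (le_of_eq ?_)
  rw [Real.cosh_abs, Real.cosh_add, Real.cosh_sub]; ring

lemma cosh_tangent_le (x y : ℝ) : Real.cosh x + Real.sinh x * (y - x) ≤ Real.cosh y := by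
  have h1 : Real.exp x * (1 + (y - x)) ≤ Real.exp y := by
    have := Real.add_one_le_exp (y - x)
    calc Real.exp x * (1 + (y - x)) ≤ Real.exp x * Real.exp (y - x) := by gcongr; linarith
      _ = Real.exp y := by rw [← Real.exp_add]; ring_nf
  have h2 : Real.exp (-x) * (1 - (y - x)) ≤ Real.exp (-y) := by
    have := Real.add_one_le_exp (-(y - x))
    calc Real.exp (-x) * (1 - (y - x)) ≤ Real.exp (-x) * Real.exp (-(y - x)) := by
          gcongr; linarith
      _ = Real.exp (-y) := by rw [← Real.exp_add]; ring_nf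
  rw [Real.cosh_eq, Real.cosh_eq, Real.sinh_eq]
  linarith

/-- The gradient of `a ↦ cosh ‖a‖`. -/
noncomputable def coshNormGrad (a : E) : E := (Real.sinh ‖a‖ / ‖a‖) • a

/-- The supporting hyperplane at `a` of the convex function `cosh ‖·‖`: the tangent line of `cosh`
combined with Cauchy–Schwarz. -/
lemma cosh_norm_sub_ge (a b : E) :
    Real.cosh ‖a‖ - inner ℝ (coshNormGrad a) b ≤ Real.cosh ‖a - b‖ := by
  rcases eq_or_ne a 0 with rfl | ha
  · simp [coshNormGrad, Real.one_le_cosh]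
  have ha' : 0 < ‖a‖ := norm_pos_iff.2 ha
  have h1 := cosh_tangent_le ‖a‖ ‖a - b‖
  have h2 : ‖a‖ ^ 2 - inner ℝ a b ≤ ‖a‖ * ‖a - b‖ := by
    have := real_inner_le_norm a (a - b)
    rwa [inner_sub_right, real_inner_self_eq_norm_sq] at this
  have h3 : -(inner ℝ a b / ‖a‖) ≤ ‖a - b‖ - ‖a‖ := by
    rw [← neg_div, div_le_iff₀ ha']; nlinarith
  have h4 : 0 ≤ Real.sinh ‖a‖ := Real.sinh_nonneg_iff.2 ha'.le
  have h5 : inner ℝ (coshNormGrad a) b = Real.sinh ‖a‖ * (inner ℝ a b / ‖a‖) := by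
    rw [coshNormGrad, real_inner_smul_left]; ring
  rw [h5]
  nlinarith [mul_le_mul_of_nonneg_left h3 h4]

/-- The one-step bound for the exponential moment: for `b` centred and independent of `a` the linear
term integrates to zero, and only a scalar factor depending on `‖b‖` remains. -/
lemma cosh_norm_add_le (a b : E) :
    Real.cosh ‖a + b‖ ≤
      Real.cosh ‖a‖ * (2 * Real.cosh ‖b‖ - 1) + inner ℝ (coshNormGrad a) b := by
  have h1 := cosh_norm_add_add_cosh_norm_sub_le a b
  have h2 := cosh_norm_sub_ge a b
  linarith

/-- Uses `2c - 1 ≤ c²` with `c = cosh x`, then `cosh x ≤ exp (x² / 2)`. -/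
lemma two_mul_cosh_sub_one_le (x : ℝ) : 2 * Real.cosh x - 1 ≤ Real.exp (x ^ 2) := by
  have h := Real.cosh_le_exp_half_sq x
  have h1 : Real.exp (x ^ 2) = Real.exp (x ^ 2 / 2) ^ 2 := by
    rw [← Real.exp_nat_mul]; ring_nf
  have h2 := Real.cosh_pos x
  nlinarith [sq_nonneg (Real.cosh x - 1)]

lemma norm_coshNormGrad_le (a : E) : ‖coshNormGrad a‖ ≤ Real.cosh ‖a‖ := by
  rcases eq_or_ne a 0 with rfl | ha
  · simp [coshNormGrad]
  have ha' : 0 < ‖a‖ := norm_pos_iff.2 ha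
  rw [coshNormGrad, norm_smul, norm_div, norm_norm, div_mul_cancel₀ _ ha'.ne', Real.norm_eq_abs,
    abs_of_nonneg (Real.sinh_nonneg_iff.2 ha'.le)]
  exact (Real.sinh_lt_cosh _).le

end CoshNorm

section Concentration

variable {Ω : Type*} [MeasurableSpace Ω] {P : Measure Ω} [IsProbabilityMeasure P]
  {ι κ : Type*} [Fintype ι]

lemma measurable_coshNormGrad :
    Measurable (coshNormGrad : EuclideanSpace ℝ ι → EuclideanSpace ℝ ι) := by
  unfold coshNormGrad
  have : Measurable Real.sinh := Real.continuous_sinh.measurable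
  fun_prop

lemma integral_inner_eq_zero_of_indepFun {U V : Ω → EuclideanSpace ℝ ι} (h : IndepFun U V P)
    (hU : AEMeasurable U P) (hV : Integrable V P) (h0 : ∫ ω, V ω ∂P = 0) {c : ℝ}
    (hUc : ∀ᵐ ω ∂P, ‖U ω‖ ≤ c) : ∫ ω, inner ℝ (U ω) (V ω) ∂P = 0 := by
  have hUi : Integrable U P := Integrable.of_bound hU.aestronglyMeasurable c hUc
  have hc : ∀ i : ι, IndepFun (fun ω => U ω i) (fun ω => V ω i) P := fun i =>
    h.comp (φ := fun x : EuclideanSpace ℝ ι => x i) (ψ := fun x : EuclideanSpace ℝ ι => x i)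
      (by fun_prop) (by fun_prop)
  have hi : ∀ (i : ι) (W : Ω → EuclideanSpace ℝ ι), Integrable W P →
      Integrable (fun ω => W ω i) P := fun i W hW =>
    (EuclideanSpace.proj (𝕜 := ℝ) i : EuclideanSpace ℝ ι →L[ℝ] ℝ).integrable_comp hW
  simp only [PiLp.inner_apply, RCLike.inner_apply, conj_trivial]
  rw [integral_finsetSum]
  · refine Finset.sum_eq_zero fun i _ => ?_
    have hVi : ∫ ω, V ω i ∂P = 0 := by
      have := (EuclideanSpace.proj (𝕜 := ℝ) i : EuclideanSpace ℝ ι →L[ℝ] ℝ).integral_comp_comm hV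
      simpa [h0] using this
    have := (hc i).symm.integral_fun_mul_eq_mul_integral (hi i V hV).aestronglyMeasurable
      (hi i U hUi).aestronglyMeasurable
    rw [this, hVi, zero_mul]
  · intro i _
    exact (hc i).symm.integrable_mul (hi i V hV) (hi i U hUi)

lemma integrable_cosh_norm {U : Ω → EuclideanSpace ℝ ι}
    (hU : AEMeasurable U P) {c : ℝ} (hUc : ∀ᵐ ω ∂P, ‖U ω‖ ≤ c) :
    Integrable (fun ω => Real.cosh ‖U ω‖) P := by
  refine Integrable.of_bound
    (Real.continuous_cosh.measurable.comp_aemeasurable hU.norm).aestronglyMeasurable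
    (Real.cosh c) ?_
  filter_upwards [hUc] with ω h
  rw [Real.norm_eq_abs, abs_of_pos (Real.cosh_pos _), Real.cosh_le_cosh, abs_of_nonneg
    (norm_nonneg _)]
  exact h.trans (le_abs_self c)

/-- Adding one summand multiplies the expectation by at most `exp (R²)`, by `cosh_norm_add_le` and
independence from the partial sum. The dimension never enters. -/
lemma integral_cosh_norm_sum_le {Y : κ → Ω → EuclideanSpace ℝ ι} (hind : iIndepFun Y P)
    (hY : ∀ u, AEMeasurable (Y u) P) {R : ℝ} (hR : ∀ u, ∀ᵐ ω ∂P, ‖Y u ω‖ ≤ R)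
    (h0 : ∀ u, ∫ ω, Y u ω ∂P = 0) (s : Finset κ) :
    ∫ ω, Real.cosh ‖∑ u ∈ s, Y u ω‖ ∂P ≤ Real.exp (s.card * R ^ 2) := by
  classical
  have hbd : ∀ s : Finset κ, ∀ᵐ ω ∂P, ‖∑ u ∈ s, Y u ω‖ ≤ s.card * R := by
    intro s
    have : ∀ᵐ ω ∂P, ∀ u ∈ s, ‖Y u ω‖ ≤ R := (ae_ball_iff s.countable_toSet).2 fun u _ => hR u
    filter_upwards [this] with ω h
    simpa using norm_sum_le_of_le s h
  have hms : ∀ s : Finset κ, AEMeasurable (fun ω => ∑ u ∈ s, Y u ω) P := fun s =>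
    Finset.aemeasurable_fun_sum s fun u _ => hY u
  induction s using Finset.induction_on with
  | empty => simp
  | insert a s ha ih =>
    have hind' : IndepFun (fun ω => ∑ u ∈ s, Y u ω) (Y a) P := by
      have := hind.indepFun_finsetSum_of_notMem₀ hY ha
      convert this using 1
      ext ω : 1
      simp
    set S : Ω → EuclideanSpace ℝ ι := fun ω => ∑ u ∈ s, Y u ω with hS
    have hGm : AEMeasurable (fun ω => coshNormGrad (S ω)) P :=
      measurable_coshNormGrad.comp_aemeasurable (hms s)
    have hGb : ∀ᵐ ω ∂P, ‖coshNormGrad (S ω)‖ ≤ Real.cosh (s.card * R) := by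
      filter_upwards [hbd s] with ω h
      refine (norm_coshNormGrad_le _).trans ?_
      rw [Real.cosh_le_cosh, abs_of_nonneg (norm_nonneg _)]
      exact h.trans (le_abs_self _)
    have hYi : Integrable (Y a) P := Integrable.of_bound (hY a).aestronglyMeasurable R (hR a)
    have hz : ∫ ω, inner ℝ (coshNormGrad (S ω)) (Y a ω) ∂P = 0 :=
      integral_inner_eq_zero_of_indepFun
        (hind'.comp measurable_coshNormGrad measurable_id) hGm hYi (h0 a) hGb
    have hIi : Integrable (fun ω => inner ℝ (coshNormGrad (S ω)) (Y a ω)) P := by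
      refine Integrable.of_bound (hGm.inner (hY a)).aestronglyMeasurable
        (Real.cosh (s.card * R) * R) ?_
      filter_upwards [hGb, hR a] with ω h1 h2
      exact (norm_inner_le_norm _ _).trans
        (mul_le_mul h1 h2 (norm_nonneg _) (Real.cosh_pos _).le)
    have hSi : Integrable (fun ω => Real.cosh ‖S ω‖) P := integrable_cosh_norm (hms s) (hbd s)
    have hle : ∀ᵐ ω ∂P, Real.cosh ‖∑ u ∈ insert a s, Y u ω‖ ≤
        Real.cosh ‖S ω‖ * Real.exp (R ^ 2) + inner ℝ (coshNormGrad (S ω)) (Y a ω) := by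
      filter_upwards [hR a] with ω h
      rw [Finset.sum_insert ha, add_comm (Y a ω)]
      refine (cosh_norm_add_le _ _).trans ?_
      have h1 : 2 * Real.cosh ‖Y a ω‖ - 1 ≤ Real.exp (R ^ 2) :=
        (two_mul_cosh_sub_one_le _).trans (Real.exp_le_exp.2 (by gcongr))
      have := mul_le_mul_of_nonneg_left h1 (Real.cosh_pos ‖S ω‖).le
      linarith
    calc ∫ ω, Real.cosh ‖∑ u ∈ insert a s, Y u ω‖ ∂P
        ≤ ∫ ω, (Real.cosh ‖S ω‖ * Real.exp (R ^ 2)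
            + inner ℝ (coshNormGrad (S ω)) (Y a ω)) ∂P :=
          integral_mono_ae (integrable_cosh_norm (hms _) (hbd _))
            ((hSi.mul_const _).add hIi) hle
      _ = (∫ ω, Real.cosh ‖S ω‖ ∂P) * Real.exp (R ^ 2) := by
          rw [integral_add (hSi.mul_const _) hIi, hz, add_zero, integral_mul_const]
      _ ≤ Real.exp (s.card * R ^ 2) * Real.exp (R ^ 2) := by gcongr
      _ = Real.exp ((insert a s).card * R ^ 2) := by
          rw [← Real.exp_add, Finset.card_insert_of_notMem ha]; push_cast; ring_nf

/-- A Hoeffding inequality for sums of bounded independent centred random vectors, with constants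
that do not depend on the dimension. -/
lemma measureReal_norm_sum_ge_le {Y : κ → Ω → EuclideanSpace ℝ ι} (hind : iIndepFun Y P)
    (hY : ∀ u, AEMeasurable (Y u) P) {R : ℝ} (hR0 : 0 < R) (hR : ∀ u, ∀ᵐ ω ∂P, ‖Y u ω‖ ≤ R)
    (h0 : ∀ u, ∫ ω, Y u ω ∂P = 0) (s : Finset κ) {t : ℝ} (ht : 0 < t) :
    P.real {ω | s.card * t ≤ ‖∑ u ∈ s, Y u ω‖} ≤
      2 * Real.exp (-(s.card * t ^ 2 / (4 * R ^ 2))) := by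
  -- The minimizer of the Chernoff exponent `c² R² - c t`, with minimum `-t² / (4 R²)`. The
  -- prefactor 2 comes from `exp x / 2 ≤ cosh x` in Markov's inequality.
  set c : ℝ := t / (2 * R ^ 2) with hc
  have hc0 : 0 < c := by positivity
  have hind' : iIndepFun (fun u ω => c • Y u ω) P :=
    hind.comp (fun _ x => c • x) (fun _ => measurable_const_smul c)
  have hm : ∀ u, AEMeasurable (fun ω => c • Y u ω) P := fun u => (hY u).const_smul c
  have hb : ∀ u, ∀ᵐ ω ∂P, ‖c • Y u ω‖ ≤ c * R := fun u => by
    filter_upwards [hR u] with ω h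
    rw [norm_smul, Real.norm_of_nonneg hc0.le]
    gcongr
  have key := integral_cosh_norm_sum_le hind' hm hb
    (fun u => by rw [integral_smul, h0 u, smul_zero]) s
  have hb' : ∀ᵐ ω ∂P, ‖∑ u ∈ s, c • Y u ω‖ ≤ s.card * (c * R) := by
    have : ∀ᵐ ω ∂P, ∀ u ∈ s, ‖c • Y u ω‖ ≤ c * R :=
      (ae_ball_iff s.countable_toSet).2 fun u _ => hb u
    filter_upwards [this] with ω h
    simpa using norm_sum_le_of_le s h
  have hint := integrable_cosh_norm (Finset.aemeasurable_fun_sum s fun u _ => hm u) hb'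
  have hmk := mul_meas_ge_le_integral_of_nonneg
    (Filter.Eventually.of_forall fun ω => (Real.cosh_pos ‖∑ u ∈ s, c • Y u ω‖).le) hint
    (Real.exp (c * (s.card * t)) / 2)
  have hsub : {ω | s.card * t ≤ ‖∑ u ∈ s, Y u ω‖} ⊆
      {ω | Real.exp (c * (s.card * t)) / 2 ≤ Real.cosh ‖∑ u ∈ s, c • Y u ω‖} := by
    intro ω h
    simp only [Set.mem_ofPred_eq] at h ⊢
    rw [← Finset.smul_sum, norm_smul, Real.norm_of_nonneg hc0.le, Real.cosh_eq]
    have : Real.exp (c * (s.card * t)) ≤ Real.exp (c * ‖∑ u ∈ s, Y u ω‖) :=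
      Real.exp_le_exp.2 (by gcongr)
    have := Real.exp_pos (-(c * ‖∑ u ∈ s, Y u ω‖))
    linarith
  have h1 := measureReal_mono hsub (μ := P)
  have h2 : Real.exp (c * (s.card * t)) / 2 * P.real {ω | s.card * t ≤ ‖∑ u ∈ s, Y u ω‖} ≤
      Real.exp (s.card * (c * R) ^ 2) :=
    (mul_le_mul_of_nonneg_left h1 (by positivity)).trans (hmk.trans key)
  have h3 : Real.exp (s.card * (c * R) ^ 2) =
      Real.exp (c * (s.card * t)) / 2 * (2 * Real.exp (-(s.card * t ^ 2 / (4 * R ^ 2)))) := by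
    have : Real.exp (s.card * (c * R) ^ 2) =
      Real.exp (c * (s.card * t)) * Real.exp (-(s.card * t ^ 2 / (4 * R ^ 2))) := by
      rw [← Real.exp_add]
      congr 1
      rw [hc]; field_simp; ring
    rw [this]; ring
  rw [h3] at h2
  exact le_of_mul_le_mul_left h2 (by positivity)

end Concentration

/-! ### Support, boundedness and Lipschitz continuity of B-splines. -/

lemma knot_mono (ℓ L : ℕ) : Monotone (knot ℓ L) := by
  intro a b hab
  unfold knot
  gcongr

lemma knot_sub_ge {ℓ L a b : ℕ} (h : knot ℓ L a < knot ℓ L b) :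
    2 / ((L : ℝ) + 1) ≤ knot ℓ L b - knot ℓ L a := by
  have hN : (0 : ℝ) < (L : ℝ) + 1 := by positivity
  unfold knot at *
  have h1 : 2 * (min (a - ℓ) (L + 1) : ℕ) / ((L : ℝ) + 1) <
      2 * (min (b - ℓ) (L + 1) : ℕ) / ((L : ℝ) + 1) := by linarith
  rw [div_lt_div_iff_of_pos_right hN] at h1
  have h2 : min (a - ℓ) (L + 1) < min (b - ℓ) (L + 1) := by
    have : ((min (a - ℓ) (L + 1) : ℕ) : ℝ) < (min (b - ℓ) (L + 1) : ℕ) := by linarith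
    exact_mod_cast this
  have h3 : ((min (a - ℓ) (L + 1) : ℕ) : ℝ) + 1 ≤ (min (b - ℓ) (L + 1) : ℕ) := by
    exact_mod_cast h2
  have h4 : 2 / ((L : ℝ) + 1) ≤ (2 * (min (b - ℓ) (L + 1) : ℕ) -
      2 * (min (a - ℓ) (L + 1) : ℕ)) / ((L : ℝ) + 1) := by
    gcongr; linarith
  rw [sub_div] at h4
  linarith

lemma knot_add {ℓ L b : ℕ} (hb : b ≤ L + 1) : knot ℓ L (ℓ + b) = -1 + 2 * b / ((L : ℝ) + 1) := by
  simp [knot, hb]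

lemma knot_of_le {ℓ L i : ℕ} (h : i ≤ ℓ) : knot ℓ L i = -1 := by
  simp [knot, Nat.sub_eq_zero_of_le h]

lemma knot_of_ge {ℓ L i : ℕ} (h : ℓ + L + 1 ≤ i) : knot ℓ L i = 1 := by
  have : min (i - ℓ) (L + 1) = L + 1 := by omega
  have hN : (L : ℝ) + 1 ≠ 0 := by positivity
  rw [knot, this]; push_cast; field_simp; norm_num

lemma bsplineAux_eq_zero {ℓ L d i : ℕ} {x : ℝ} (hx : x ∈ Set.Icc (-1 : ℝ) 1)
    (h : x ∉ Set.Icc (knot ℓ L i) (knot ℓ L (i + d + 1))) : bsplineAux ℓ L d i x = 0 := by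
  induction d generalizing i with
  | zero =>
    rw [bsplineAux, if_neg]
    rintro (h1 | ⟨rfl, rfl⟩)
    · exact h ⟨h1.1, h1.2.le⟩
    · refine h ⟨?_, ?_⟩
      · have := knot_mono ℓ L (show ℓ + L ≤ ℓ + L + 1 by omega)
        rwa [knot_of_ge le_rfl] at this
      · rw [knot_of_ge (by omega)]
  | succ d ih =>
    rw [bsplineAux, ih, ih, mul_zero, mul_zero, add_zero]
    · intro h'
      exact h ⟨(knot_mono ℓ L (by omega)).trans h'.1, h'.2.trans (knot_mono ℓ L (by omega))⟩
    · intro h'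
      exact h ⟨h'.1, h'.2.trans (knot_mono ℓ L (by omega))⟩

lemma abs_div_sub_le_one {s e y : ℝ} (hy : 0 ≤ y) (hye : y ≤ e - s) : |y / (e - s)| ≤ 1 := by
  rw [abs_of_nonneg (div_nonneg hy (hy.trans hye))]
  exact div_le_one_of_le₀ hye (hy.trans hye)

/-- Each recursion step adds two terms whose weights are at most one wherever the spline they
multiply is nonzero. Only a bound independent of `L` matters, so the doubling is harmless. -/
lemma abs_bsplineAux_le (ℓ L d i : ℕ) {x : ℝ} (hx : x ∈ Set.Icc (-1 : ℝ) 1) :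
    |bsplineAux ℓ L d i x| ≤ 2 ^ d := by
  induction d generalizing i with
  | zero =>
    rw [bsplineAux]
    split_ifs <;> simp
  | succ d ih =>
    have key : ∀ (w : ℝ) (j : ℕ),
        (x ∈ Set.Icc (knot ℓ L j) (knot ℓ L (j + d + 1)) → |w| ≤ 1) →
        |w * bsplineAux ℓ L d j x| ≤ 2 ^ d := by
      intro w j hw
      by_cases hj : x ∈ Set.Icc (knot ℓ L j) (knot ℓ L (j + d + 1))
      · rw [abs_mul]
        calc _ ≤ 1 * |bsplineAux ℓ L d j x| := by gcongr; exact hw hj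
          _ ≤ _ := by rw [one_mul]; exact ih j
      · rw [bsplineAux_eq_zero hx hj]; simp
    rw [bsplineAux]
    refine (abs_add_le _ _).trans ?_
    have h1 := key ((x - knot ℓ L i) / (knot ℓ L (i + d + 1) - knot ℓ L i)) i
      fun h => abs_div_sub_le_one (by linarith [h.1]) (by linarith [h.2])
    have h2 := key ((knot ℓ L (i + d + 2) - x) / (knot ℓ L (i + d + 2) - knot ℓ L (i + 1))) (i + 1)
      fun h => abs_div_sub_le_one
        (by have := h.2; rw [show i + 1 + d + 1 = i + d + 2 by ring] at this; linarith)
        (by linarith [h.1])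
    rw [pow_succ]; linarith

lemma bsplineAux_zero_of_lt {ℓ L i : ℕ} (h : i < ℓ) (x : ℝ) : bsplineAux ℓ L 0 i x = 0 := by
  rw [bsplineAux, if_neg]
  rw [knot_of_le h.le, knot_of_le h]
  rintro (h1 | ⟨h1, -⟩)
  · linarith
  · omega

lemma bsplineAux_zero_of_gt {ℓ L i : ℕ} (h : ℓ + L < i) (x : ℝ) : bsplineAux ℓ L 0 i x = 0 := by
  rw [bsplineAux, if_neg]
  rw [knot_of_ge (by omega), knot_of_ge (by omega)]
  rintro (h1 | ⟨h1, -⟩)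
  · linarith
  · omega

/-- The degree-zero splines in the coordinate in which the knots are the integers. -/
lemma bsplineAux_zero_add (ℓ : ℕ) {L c : ℕ} (hc : c ≤ L) (y : ℝ) :
    bsplineAux ℓ L 0 (ℓ + c) (-1 + 2 * y / ((L : ℝ) + 1)) =
      open Classical in if ((c : ℝ) ≤ y ∧ y < c + 1) ∨ (c = L ∧ y = L + 1) then 1 else 0 := by
  have hN : (0 : ℝ) < (L : ℝ) + 1 := by positivity
  rw [bsplineAux, add_assoc ℓ c 1, knot_add (by omega), knot_add (by omega)]
  congr 1
  have h1 : (-1 + 2 * (c : ℝ) / ((L : ℝ) + 1) ≤ -1 + 2 * y / ((L : ℝ) + 1)) ↔ (c : ℝ) ≤ y := by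
    rw [add_le_add_iff_left, div_le_div_iff_of_pos_right hN]
    constructor <;> intro h <;> linarith
  have h2 : (-1 + 2 * y / ((L : ℝ) + 1) < -1 + 2 * ((c + 1 : ℕ) : ℝ) / ((L : ℝ) + 1)) ↔
      y < c + 1 := by
    rw [add_lt_add_iff_left, div_lt_div_iff_of_pos_right hN]
    push_cast
    constructor <;> intro h <;> linarith
  have h3 : (-1 + 2 * y / ((L : ℝ) + 1) = 1) ↔ y = L + 1 := by
    constructor
    · intro h
      have : 2 * y / ((L : ℝ) + 1) = 2 := by linarith
      rw [div_eq_iff hN.ne'] at this; linarith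
    · rintro rfl; field_simp; norm_num
  rw [h1, h2, h3, add_right_inj]

/-- The linear B-splines are the hat functions. -/
lemma bsplineAux_one_add (ℓ : ℕ) {L i b : ℕ} (hi : i + 1 = ℓ + b) (hb : b ≤ L + 1) {y : ℝ}
    (hy0 : 0 ≤ y) (hy1 : y ≤ L + 1) :
    bsplineAux ℓ L 1 i (-1 + 2 * y / ((L : ℝ) + 1)) = max 0 (1 - |y - b|) := by
  have hN : (0 : ℝ) < (L : ℝ) + 1 := by positivity
  have hleft : b = 0 → bsplineAux ℓ L 0 i (-1 + 2 * y / ((L : ℝ) + 1)) = 0 := fun h =>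
    bsplineAux_zero_of_lt (by omega) _
  have hright : b = L + 1 → bsplineAux ℓ L 0 (i + 1) (-1 + 2 * y / ((L : ℝ) + 1)) = 0 := fun h =>
    bsplineAux_zero_of_gt (by omega) _
  have kb : knot ℓ L (i + 1) = -1 + 2 * b / ((L : ℝ) + 1) := by rw [hi, knot_add hb]
  have wl : ∀ c : ℕ, b = c + 1 → (-1 + 2 * y / ((L : ℝ) + 1) - knot ℓ L i) /
      (knot ℓ L (i + 1) - knot ℓ L i) = y - c := by
    intro c hc
    have : i = ℓ + c := by omega
    rw [kb, this, knot_add (by omega), hc]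
    push_cast
    field_simp
    ring
  have wr : b ≤ L → (knot ℓ L (i + 2) - (-1 + 2 * y / ((L : ℝ) + 1))) /
      (knot ℓ L (i + 2) - knot ℓ L (i + 1)) = b + 1 - y := by
    intro hbL
    have : i + 2 = ℓ + (b + 1) := by omega
    rw [kb, this, knot_add (by omega)]
    push_cast
    field_simp
    ring
  rw [bsplineAux]
  simp only [add_zero]
  -- At the first and last knot one of the two degree-zero pieces vanishes, leaving half a hat; at
  -- an interior knot both pieces contribute.
  rcases Nat.eq_zero_or_pos b with h0 | h0
  · rw [hleft h0, mul_zero, zero_add, wr (by omega), hi, bsplineAux_zero_add ℓ (by omega)]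
    subst h0
    rw [Nat.cast_zero, sub_zero, abs_of_nonneg hy0]
    split_ifs with h
    · rcases h with h | ⟨h, h'⟩
      · rw [max_eq_right] <;> linarith [h.2]
      · subst h
        rw [h']; norm_num
    · push Not at h
      rw [max_eq_left, mul_zero]
      linarith [h.1 hy0]
  · obtain ⟨c, rfl⟩ : ∃ c, b = c + 1 := ⟨b - 1, by omega⟩
    have hic : i = ℓ + c := by omega
    rw [wl c rfl]
    rcases eq_or_lt_of_le hb with h1 | h1
    · rw [hright h1, mul_zero, add_zero, hic, bsplineAux_zero_add ℓ (by omega)]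
      have hcL : c = L := by omega
      subst hcL
      push_cast
      rw [abs_of_nonpos (by linarith)]
      split_ifs with h
      · rw [max_eq_right] <;> rcases h with h | h <;> linarith [h.1, h.2]
      · push Not at h
        rw [max_eq_left, mul_zero]
        rcases le_or_gt (c : ℝ) y with h2 | h2
        · exact absurd (le_antisymm hy1 (h.1 h2)) (h.2 rfl)
        · linarith
    · rw [wr (by omega), hi, hic, bsplineAux_zero_add ℓ (by omega),
        bsplineAux_zero_add ℓ (by omega)]
      push_cast
      have hL : (c : ℝ) + 1 + 1 ≤ L + 1 := by exact_mod_cast (by omega : c + 1 + 1 ≤ L + 1)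
      have e1 : ¬ (c = L ∧ y = L + 1) := fun h => by omega
      simp only [e1, or_false]
      rcases lt_or_ge y c with h2 | h2
      · rw [if_neg (by intro h; linarith [h.1]), if_neg, max_eq_left]
        · ring
        · rw [abs_of_nonpos (by linarith)]; linarith
        · rintro (h | h) <;> linarith [h.1, h.2]
      rcases lt_or_ge y (c + 1) with h3 | h3
      · rw [if_pos ⟨h2, h3⟩, if_neg, max_eq_right]
        · rw [abs_of_nonpos (by linarith)]; ring
        · rw [abs_of_nonpos (by linarith)]; linarith
        · rintro (h | h) <;> linarith [h.1, h.2]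
      rcases le_or_gt y (c + 1 + 1) with h4 | h4
      · rw [if_neg (by intro h; linarith [h.2]), abs_of_nonneg (by linarith),
          max_eq_right (by linarith)]
        -- At the right end of the hat the weight is zero, so the value of the degree-zero piece
        -- there, which depends on the closed-right convention, is immaterial.
        rcases eq_or_lt_of_le h4 with h5 | h5
        · rw [h5]; ring
        · rw [if_pos (Or.inl ⟨h3, h5⟩)]; ring
      · rw [if_neg (by intro h; linarith [h.2]), abs_of_nonneg (by linarith),
          max_eq_left (by linarith), if_neg]
        · ring
        · rintro (h | ⟨h, h'⟩)
          · linarith [h.2]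
          · rw [← h] at h'
            push_cast at h'
            linarith

/-- The Lipschitz induction starts here because degree-zero splines jump. Indices whose linear
spline is not a hat give the zero function. -/
lemma abs_bsplineAux_one_sub_le {ℓ : ℕ} (L i : ℕ) {x y : ℝ}
    (hx : x ∈ Set.Icc (-1 : ℝ) 1) (hy : y ∈ Set.Icc (-1 : ℝ) 1) :
    |bsplineAux ℓ L 1 i x - bsplineAux ℓ L 1 i y| ≤ ((L : ℝ) + 1) / 2 * |x - y| := by
  have hN : (0 : ℝ) < (L : ℝ) + 1 := by positivity
  by_cases h : ℓ ≤ i + 1 ∧ i ≤ ℓ + L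
  · obtain ⟨b, hb⟩ : ∃ b, i + 1 = ℓ + b := ⟨i + 1 - ℓ, by omega⟩
    have key : ∀ z ∈ Set.Icc (-1 : ℝ) 1, bsplineAux ℓ L 1 i z =
        max 0 (1 - |((L : ℝ) + 1) / 2 * (z + 1) - b|) := by
      intro z hz
      have hbL : b ≤ L + 1 := by omega
      rw [← bsplineAux_one_add (L := L) ℓ hb hbL (by nlinarith [hz.1]) (by nlinarith [hz.2])]
      congr 1
      field_simp
      ring
    rw [key x hx, key y hy, max_comm 0, max_comm 0]
    refine (abs_max_sub_max_le_abs _ _ 0).trans ?_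
    rw [show (1 - |((L : ℝ) + 1) / 2 * (x + 1) - b|) - (1 - |((L : ℝ) + 1) / 2 * (y + 1) - b|) =
      |((L : ℝ) + 1) / 2 * (y + 1) - b| - |((L : ℝ) + 1) / 2 * (x + 1) - b| by ring]
    refine (abs_abs_sub_abs_le _ _).trans (le_of_eq ?_)
    rw [show ((L : ℝ) + 1) / 2 * (y + 1) - b - (((L : ℝ) + 1) / 2 * (x + 1) - b) =
      ((L : ℝ) + 1) / 2 * (y - x) by ring, abs_mul, abs_of_pos (by positivity), abs_sub_comm]
  · have key : ∀ z, bsplineAux ℓ L 1 i z = 0 := by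
      intro z
      rw [bsplineAux]
      rcases lt_or_ge (i + 1) ℓ with h' | h'
      · rw [bsplineAux_zero_of_lt (by omega), bsplineAux_zero_of_lt (by omega)]; ring
      · rw [bsplineAux_zero_of_gt (by omega), bsplineAux_zero_of_gt (by omega)]; ring
    rw [key, key, sub_zero, abs_zero]
    positivity

/-- A product rule for Cox–de Boor terms: the weight is bounded by one only on the support `T`. If
just one point lies in `T`, the factor `f` vanishes at the other and its own Lipschitz bound
suffices. -/
lemma abs_mul_sub_mul_le {f w : ℝ → ℝ} {S T : Set ℝ} {K c b : ℝ} (hK : 0 ≤ K) (hb : 0 ≤ b)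
    (hf : ∀ x ∈ S, ∀ y ∈ S, |f x - f y| ≤ K * |x - y|) (hfb : ∀ x ∈ S, |f x| ≤ b)
    (hfT : ∀ x ∈ S, x ∉ T → f x = 0) (hw : ∀ x ∈ T, |w x| ≤ 1)
    (hwL : ∀ x y, |w x - w y| ≤ c * |x - y|) (hc : 0 ≤ c) {x y : ℝ} (hx : x ∈ S) (hy : y ∈ S) :
    |w x * f x - w y * f y| ≤ (K + b * c) * |x - y| := by
  have hnn : 0 ≤ b * c * |x - y| := by positivity
  by_cases hxT : x ∈ T
  · calc |w x * f x - w y * f y| = |w x * (f x - f y) + (w x - w y) * f y| := by ring_nf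
      _ ≤ |w x * (f x - f y)| + |(w x - w y) * f y| := abs_add_le _ _
      _ ≤ 1 * (K * |x - y|) + (c * |x - y|) * b := by
          rw [abs_mul, abs_mul]
          gcongr
          · exact hw x hxT
          · exact hf x hx y hy
          · exact hwL x y
          · exact hfb y hy
      _ = _ := by ring
  · have hfx := hfT x hx hxT
    by_cases hyT : y ∈ T
    · have := hf x hx y hy
      rw [hfx, zero_sub, abs_neg] at this
      rw [hfx, mul_zero, zero_sub, abs_neg, abs_mul]
      calc |w y| * |f y| ≤ 1 * (K * |x - y|) := by gcongr; exact hw y hyT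
        _ ≤ _ := by linarith
    · rw [hfx, hfT y hy hyT, mul_zero, mul_zero, sub_zero, abs_zero]
      positivity

lemma abs_div_knot_sub_le {ℓ L a b : ℕ} (hab : a ≤ b) (z : ℝ) :
    |z / (knot ℓ L b - knot ℓ L a)| ≤ ((L : ℝ) + 1) / 2 * |z| := by
  have hN : (0 : ℝ) < (L : ℝ) + 1 := by positivity
  rcases eq_or_lt_of_le (knot_mono ℓ L hab) with h | h
  · rw [h, sub_self, div_zero, abs_zero]; positivity
  · have h1 := knot_sub_ge h
    rw [abs_div, abs_of_pos (sub_pos.2 h), div_eq_mul_inv, mul_comm]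
    gcongr
    rw [inv_le_comm₀ (sub_pos.2 h) (by positivity), inv_div]
    exact h1

/-- The constants satisfy `K (d + 1) = 2 * (K d + 2 ^ (d + 1) * (L + 1) / 2)`, where `K d` belongs
to degree `d + 1`: two terms per step, each governed by `abs_mul_sub_mul_le`. -/
lemma abs_bsplineAux_sub_le (ℓ L d i : ℕ) {x y : ℝ}
    (hx : x ∈ Set.Icc (-1 : ℝ) 1) (hy : y ∈ Set.Icc (-1 : ℝ) 1) :
    |bsplineAux ℓ L (d + 1) i x - bsplineAux ℓ L (d + 1) i y| ≤
      ((d + 1) * 2 ^ d * ((L : ℝ) + 1)) * |x - y| := by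
  have hN : (0 : ℝ) < (L : ℝ) + 1 := by positivity
  induction d generalizing i x y with
  | zero =>
    refine (abs_bsplineAux_one_sub_le L i hx hy).trans ?_
    gcongr
    norm_num
    linarith
  | succ d ih =>
    have key : ∀ (w : ℝ → ℝ) (j : ℕ),
        (∀ z ∈ Set.Icc (knot ℓ L j) (knot ℓ L (j + (d + 1) + 1)), |w z| ≤ 1) →
        (∀ x y, |w x - w y| ≤ ((L : ℝ) + 1) / 2 * |x - y|) →
        |w x * bsplineAux ℓ L (d + 1) j x - w y * bsplineAux ℓ L (d + 1) j y| ≤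
          ((d + 1) * 2 ^ d * ((L : ℝ) + 1) + 2 ^ (d + 1) * (((L : ℝ) + 1) / 2)) * |x - y| := by
      intro w j h1 h2
      exact abs_mul_sub_mul_le (by positivity) (by positivity)
        (fun x hx y hy => ih j hx hy) (fun x hx => abs_bsplineAux_le ℓ L (d + 1) j hx)
        (fun x hx h => bsplineAux_eq_zero hx h) h1 h2 (by positivity) hx hy
    have h1 := key
      (fun z => (z - knot ℓ L i) / (knot ℓ L (i + (d + 1) + 1) - knot ℓ L i)) i
      (fun z h => abs_div_sub_le_one (by linarith [h.1]) (by linarith [h.2]))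
      (fun x y => by
        rw [← sub_div, sub_sub_sub_cancel_right]
        exact abs_div_knot_sub_le (by omega) _)
    have h2 := key
      (fun z => (knot ℓ L (i + (d + 1) + 2) - z) /
        (knot ℓ L (i + (d + 1) + 2) - knot ℓ L (i + 1))) (i + 1)
      (fun z h => abs_div_sub_le_one
        (by have := h.2; rw [show i + 1 + (d + 1) + 1 = i + (d + 1) + 2 by ring] at this; linarith)
        (by linarith [h.1]))
      (fun x y => by
        rw [← sub_div, sub_sub_sub_cancel_left, abs_sub_comm x y]
        exact abs_div_knot_sub_le (by omega) _)
    rw [bsplineAux, bsplineAux.eq_2 ℓ L i y, add_sub_add_comm]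
    calc _ ≤ _ := abs_add_le _ _
      _ ≤ _ := add_le_add h1 h2
      _ = _ := by push_cast; ring

/-! ### Lipschitz dependence of the design entries on the scores. -/

section Design

variable {n : ℕ}

lemma abs_inv_mul_sum_le {f : Fin n → ℝ} {b : ℝ} (hn : 1 ≤ n) (h : ∀ u, |f u| ≤ b) :
    |(n : ℝ)⁻¹ * ∑ u, f u| ≤ b := by
  have hn' : (0 : ℝ) < n := by exact_mod_cast hn
  rw [abs_mul, abs_of_pos (inv_pos.2 hn'), inv_mul_le_iff₀ hn']
  calc |∑ u, f u| ≤ ∑ u, |f u| := Finset.abs_sum_le_sum_abs _ _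
    _ ≤ ∑ _u : Fin n, b := Finset.sum_le_sum fun u _ => h u
    _ = n * b := by simp

lemma abs_centredSpline_le {ℓ L : ℕ} (hn : 1 ≤ n) (k : Fin (L + ℓ + 1)) {x : Fin n → ℝ}
    (hx : ∀ u, x u ∈ Set.Icc (-1 : ℝ) 1) (u : Fin n) :
    |centredSpline ℓ L k x u| ≤ 2 * 2 ^ ℓ := by
  have h : ∀ u, |bspline ℓ L k (x u)| ≤ 2 ^ ℓ := fun u => abs_bsplineAux_le _ _ _ _ (hx u)
  refine (abs_sub _ _).trans ?_
  linarith [h u, abs_inv_mul_sum_le hn h]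

/-- Centring couples all observations, so the bound is on the sum over `u`; subtracting the mean at
most doubles the total error. -/
lemma sum_abs_centredSpline_sub_le {ℓ L : ℕ} (hℓ : 1 ≤ ℓ) (hn : 1 ≤ n) (k : Fin (L + ℓ + 1))
    {x y : Fin n → ℝ} (hx : ∀ u, x u ∈ Set.Icc (-1 : ℝ) 1) (hy : ∀ u, y u ∈ Set.Icc (-1 : ℝ) 1) :
    ∑ u, |centredSpline ℓ L k x u - centredSpline ℓ L k y u| ≤
      (ℓ * 2 ^ ℓ * ((L : ℝ) + 1)) * ∑ u, |x u - y u| := by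
  have hn' : (0 : ℝ) < n := by exact_mod_cast hn
  obtain ⟨d, rfl⟩ : ∃ d, ℓ = d + 1 := ⟨ℓ - 1, by omega⟩
  have h1 : ∀ u, |bspline (d + 1) L k (x u) - bspline (d + 1) L k (y u)| ≤
      ((d + 1) * 2 ^ d * ((L : ℝ) + 1)) * |x u - y u| := fun u =>
    abs_bsplineAux_sub_le _ _ _ _ (hx u) (hy u)
  set S := ∑ u, |bspline (d + 1) L k (x u) - bspline (d + 1) L k (y u)| with hS
  have h2 : |(n : ℝ)⁻¹ * ∑ v, bspline (d + 1) L k (y v) -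
      (n : ℝ)⁻¹ * ∑ v, bspline (d + 1) L k (x v)| ≤ (n : ℝ)⁻¹ * S := by
    rw [← mul_sub, ← Finset.sum_sub_distrib, abs_mul, abs_of_pos (inv_pos.2 hn')]
    gcongr
    refine (Finset.abs_sum_le_sum_abs _ _).trans (le_of_eq ?_)
    exact Finset.sum_congr rfl fun u _ => abs_sub_comm _ _
  calc ∑ u, |centredSpline (d + 1) L k x u - centredSpline (d + 1) L k y u|
      ≤ ∑ u, (|bspline (d + 1) L k (x u) - bspline (d + 1) L k (y u)| + (n : ℝ)⁻¹ * S) := by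
        refine Finset.sum_le_sum fun u _ => ?_
        unfold centredSpline
        calc _ ≤ _ := le_trans (le_of_eq (by ring_nf)) (abs_add_le _ _)
          _ ≤ _ := add_le_add le_rfl h2
    _ = 2 * S := by
        rw [Finset.sum_add_distrib]
        simp only [Finset.sum_const, Finset.card_univ, Fintype.card_fin, nsmul_eq_mul, ← hS]
        field_simp
        ring
    _ ≤ 2 * ∑ u, ((d + 1) * 2 ^ d * ((L : ℝ) + 1)) * |x u - y u| := by
        gcongr
        exact Finset.sum_le_sum fun u _ => h1 u
    _ = _ := by rw [← Finset.mul_sum]; push_cast; ring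

/-- From `a b - a' b' = b (a - a') + a' (b - b')` and boundedness of the centred splines. Only mean
absolute score errors enter, so no uniform control over the observations is required. -/
lemma abs_designEntry_sub_le {ℓ L p m : ℕ} (hℓ : 1 ≤ ℓ) (hn : 1 ≤ n) {Ψ : ℝ → ℝ} {Λ : ℝ≥0}
    (hΨ : LipschitzWith Λ Ψ) (hΨI : ∀ x, Ψ x ∈ Set.Icc (-1 : ℝ) 1) (z w : Fin n → Fin p → Fin m → ℝ)
    (i j : Fin p) (r q : Fin m) (k l : Fin (L + ℓ + 1)) :
    |designEntry ℓ L (fun u i r => Ψ (z u i r)) i j r q k l -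
      designEntry ℓ L (fun u i r => Ψ (w u i r)) i j r q k l| ≤
      2 * ℓ * 4 ^ ℓ * Λ * ((L : ℝ) + 1) *
        ((n : ℝ)⁻¹ * ∑ u, |z u i r - w u i r| + (n : ℝ)⁻¹ * ∑ u, |z u j q - w u j q|) := by
  have hn' : (0 : ℝ) < n := by exact_mod_cast hn
  have key : ∀ (i : Fin p) (r : Fin m) (k : Fin (L + ℓ + 1)),
      ∑ u, |centredSpline ℓ L k (fun v => Ψ (z v i r)) u -
        centredSpline ℓ L k (fun v => Ψ (w v i r)) u| ≤
        (ℓ * 2 ^ ℓ * ((L : ℝ) + 1)) * (Λ * ∑ u, |z u i r - w u i r|) := by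
    intro i r k
    refine (sum_abs_centredSpline_sub_le hℓ hn k (fun u => hΨI _) (fun u => hΨI _)).trans ?_
    rw [Finset.mul_sum (a := (Λ : ℝ))]
    gcongr with u _
    have := hΨ.dist_le_mul (z u i r) (w u i r)
    rwa [Real.dist_eq, Real.dist_eq] at this
  have hb : ∀ (z : Fin n → Fin p → Fin m → ℝ) (i : Fin p) (r : Fin m) (k : Fin (L + ℓ + 1)) u,
      |centredSpline ℓ L k (fun v => Ψ (z v i r)) u| ≤ 2 * 2 ^ ℓ := fun z i r k u =>
    abs_centredSpline_le hn k (fun u => hΨI _) u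
  unfold designEntry
  rw [← mul_sub, ← Finset.sum_sub_distrib, abs_mul, abs_of_pos (inv_pos.2 hn')]
  set a := fun u => centredSpline ℓ L k (fun v => Ψ (z v i r)) u
  set a' := fun u => centredSpline ℓ L k (fun v => Ψ (w v i r)) u
  set b := fun u => centredSpline ℓ L l (fun v => Ψ (z v j q)) u
  set b' := fun u => centredSpline ℓ L l (fun v => Ψ (w v j q)) u
  have h1 : |∑ u, (a u * b u - a' u * b' u)| ≤
      2 * 2 ^ ℓ * ∑ u, |a u - a' u| + 2 * 2 ^ ℓ * ∑ u, |b u - b' u| := by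
    refine (Finset.abs_sum_le_sum_abs _ _).trans ?_
    rw [Finset.mul_sum, Finset.mul_sum, ← Finset.sum_add_distrib]
    refine Finset.sum_le_sum fun u _ => ?_
    calc |a u * b u - a' u * b' u| = |b u * (a u - a' u) + a' u * (b u - b' u)| := by ring_nf
      _ ≤ |b u| * |a u - a' u| + |a' u| * |b u - b' u| := by
          rw [← abs_mul, ← abs_mul]; exact abs_add_le _ _
      _ ≤ _ := by
          gcongr
          · exact hb z j q l u
          · exact hb w i r k u
  have h2 := key i r k
  have h3 := key j q l
  have h4 : (4 : ℝ) ^ ℓ = 2 ^ ℓ * 2 ^ ℓ := by rw [← mul_pow]; norm_num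
  calc _ ≤ (n : ℝ)⁻¹ * (2 * 2 ^ ℓ * ((ℓ * 2 ^ ℓ * ((L : ℝ) + 1)) *
        (Λ * ∑ u, |z u i r - w u i r|)) + 2 * 2 ^ ℓ * ((ℓ * 2 ^ ℓ * ((L : ℝ) + 1)) *
        (Λ * ∑ u, |z u j q - w u j q|))) := by
        gcongr
        refine h1.trans ?_
        gcongr
    _ = _ := by rw [h4]; ring

end Design

/-! ### Variational bounds for the population and sample eigenvalues. -/

lemma exists_ne_zero_sum_smul_orthogonal {E : Type*} [NormedAddCommGroup E] [InnerProductSpace ℝ E]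
    {r : ℕ} (u : Fin (r + 1) → E) (w : Fin r → E) :
    ∃ c : Fin (r + 1) → ℝ, c ≠ 0 ∧ ∀ s, inner ℝ (w s) (∑ a, c a • u a) = 0 := by
  let f : (Fin (r + 1) → ℝ) →ₗ[ℝ] (Fin r → ℝ) :=
    LinearMap.pi fun s => (innerₛₗ ℝ (w s)).comp (Fintype.linearCombination ℝ u)
  have hk : LinearMap.ker f ≠ ⊥ := LinearMap.ker_ne_bot_of_finrank_lt (by simp)
  obtain ⟨c, hc, hc0⟩ := Submodule.exists_mem_ne_zero_of_ne_bot hk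
  refine ⟨c, hc0, fun s => ?_⟩
  have := congrFun (LinearMap.mem_ker.1 hc) s
  simpa [f, Fintype.linearCombination_apply] using this

section Spectral

variable {T : L2I → L2I} {lam : ℕ → ℝ} {phi : ℕ → L2I}

lemma IsSpectralDecomposition.hasSum_inner (h : IsSpectralDecomposition T lam phi) (f g : L2I) :
    HasSum (fun r => lam r * inner ℝ (phi r) f * inner ℝ (phi r) g) (inner ℝ (T f) g) := by
  have := (h.hasSum f).mapL (innerSL ℝ g)
  simp only [innerSL_apply_apply, inner_smul_right] at this
  rw [real_inner_comm] at this
  simpa only [real_inner_comm g] using this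

lemma IsSpectralDecomposition.inner_eigen (h : IsSpectralDecomposition T lam phi) (f : L2I)
    (r : ℕ) : inner ℝ (T f) (phi r) = lam r * inner ℝ (phi r) f := by
  refine (h.hasSum_inner f (phi r)).unique ?_
  convert hasSum_single r ?_ using 1
  · rw [real_inner_self_eq_norm_sq, h.orthonormal.1]; ring
  · intro a ha
    rw [h.orthonormal.2 ha, mul_zero]

lemma hasSum_sq_inner_le (h : Orthonormal ℝ phi) (f : L2I) :
    Summable (fun r => inner ℝ (phi r) f ^ 2) ∧ ∑' r, inner ℝ (phi r) f ^ 2 ≤ ‖f‖ ^ 2 := by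
  have h1 := h.inner_products_summable (x := f)
  have h2 := h.tsum_inner_products_le (x := f)
  simp only [Real.norm_eq_abs, sq_abs] at h1 h2
  exact ⟨h1, h2⟩

lemma IsSpectralDecomposition.inner_self_le (h : IsSpectralDecomposition T lam phi) {r : ℕ}
    (hr : 0 ≤ lam r) {v : L2I} (hv : ∀ a < r, inner ℝ (phi a) v = 0) :
    inner ℝ (T v) v ≤ lam r * ‖v‖ ^ 2 := by
  obtain ⟨h1, h2⟩ := hasSum_sq_inner_le h.orthonormal v
  refine (hasSum_le (fun a => ?_) (h.hasSum_inner v v) (h1.hasSum.mul_left (lam r))).trans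
    (mul_le_mul_of_nonneg_left h2 hr)
  rcases lt_or_ge a r with ha | ha
  · simp [hv a ha]
  · rw [mul_assoc, ← sq]
    exact mul_le_mul_of_nonneg_right (h.antitone ha) (sq_nonneg _)

lemma IsSpectralDecomposition.le_inner_self (h : IsSpectralDecomposition T lam phi) {r : ℕ}
    (c : Fin (r + 1) → ℝ) :
    lam r * ‖∑ a, c a • phi a‖ ^ 2 ≤ inner ℝ (T (∑ a, c a • phi a)) (∑ a, c a • phi a) := by
  set v := ∑ a, c a • phi a with hv
  have ho : Orthonormal ℝ (fun a : Fin (r + 1) => phi a) :=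
    h.orthonormal.comp _ Fin.val_injective
  have hin : inner ℝ (T v) v = ∑ a : Fin (r + 1), lam a * (c a) ^ 2 := by
    conv_lhs => rw [hv, inner_sum]
    refine Finset.sum_congr rfl fun a _ => ?_
    have e : inner ℝ (phi a) v = c a := ho.inner_right_fintype c a
    rw [inner_smul_right, h.inner_eigen, e]
    ring
  have hno : ‖v‖ ^ 2 = ∑ a, (c a) ^ 2 := by
    rw [← real_inner_self_eq_norm_sq, hv, ho.inner_sum]
    simp [sq]
  rw [hin, hno, Finset.mul_sum]
  gcongr with a _
  exact h.antitone (Nat.lt_succ_iff.1 a.2)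

end Spectral

section Sample

variable {n m : ℕ} {x : Fin n → L2I} {lamHat : Fin m → ℝ} {phiHat : Fin m → L2I}

lemma inner_sampleCovOp (x : Fin n → L2I) (f g : L2I) :
    inner ℝ (sampleCovOp x f) g = (n : ℝ)⁻¹ * ∑ u, inner ℝ (x u) f * inner ℝ (x u) g := by
  simp [sampleCovOp, real_inner_smul_left, sum_inner]

lemma sampleCovOp_symm (x : Fin n → L2I) (f g : L2I) :
    inner ℝ (sampleCovOp x f) g = inner ℝ (sampleCovOp x g) f := by
  simp only [inner_sampleCovOp, mul_comm]

lemma sampleCovOp_add (x : Fin n → L2I) (f g : L2I) :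
    sampleCovOp x (f + g) = sampleCovOp x f + sampleCovOp x g := by
  simp [sampleCovOp, inner_add_right, add_smul, Finset.sum_add_distrib]

lemma sampleCovOp_sum_smul (x : Fin n → L2I) {ι : Type*} [Fintype ι] (c : ι → ℝ) (f : ι → L2I) :
    sampleCovOp x (∑ a, c a • f a) = ∑ a, c a • sampleCovOp x (f a) := by
  simp only [sampleCovOp, inner_sum, inner_smul_right, Finset.sum_smul, Finset.smul_sum, smul_smul]
  rw [Finset.sum_comm]
  refine Finset.sum_congr rfl fun a _ => Finset.sum_congr rfl fun u _ => ?_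
  congr 1
  ring

lemma inner_sampleCovOp_eigen_sum (h : IsLeadingEigensystem (sampleCovOp x) lamHat phiHat)
    (c : Fin m → ℝ) (w : L2I) :
    inner ℝ (sampleCovOp x (∑ s, c s • phiHat s)) w =
      ∑ s, lamHat s * c s * inner ℝ (phiHat s) w := by
  rw [sampleCovOp_sum_smul, sum_inner]
  refine Finset.sum_congr rfl fun s _ => ?_
  rw [h.eigen, smul_smul, real_inner_smul_left]
  ring

/-- Splits `v` into its projection `q` on the `phiHat s` and a remainder `w`. The cross terms vanish
since the span is invariant; `leading` bounds the form at `w`, monotonicity of the eigenvalues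
bounds it at `q`. -/
lemma IsLeadingEigensystem.inner_self_le (h : IsLeadingEigensystem (sampleCovOp x) lamHat phiHat)
    {r : Fin m} {v : L2I} (hv : ∀ s < r, inner ℝ (phiHat s) v = 0) :
    inner ℝ (sampleCovOp x v) v ≤ lamHat r * ‖v‖ ^ 2 := by
  set d : Fin m → ℝ := fun s => inner ℝ (phiHat s) v with hd
  set q := ∑ s, d s • phiHat s with hq
  set w := v - q with hw
  have hqs : ∀ s, inner ℝ (phiHat s) q = d s := fun s => by
    rw [hq, h.orthonormal.inner_right_fintype]
  have hws : ∀ s, inner ℝ (phiHat s) w = 0 := fun s => by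
    rw [hw, inner_sub_right, hqs, sub_self]
  have hvqw : v = q + w := by rw [hw]; abel
  have h1 : inner ℝ (sampleCovOp x q) q = ∑ s, lamHat s * d s ^ 2 := by
    conv_lhs => rw [hq]
    rw [inner_sampleCovOp_eigen_sum h]
    refine Finset.sum_congr rfl fun s _ => ?_
    rw [← hq, hqs]; ring
  have h2 : inner ℝ (sampleCovOp x q) w = 0 := by
    rw [hq, inner_sampleCovOp_eigen_sum h]
    exact Finset.sum_eq_zero fun s _ => by rw [hws, mul_zero]
  have h3 : inner ℝ q w = 0 := by
    rw [hq, sum_inner]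
    exact Finset.sum_eq_zero fun s _ => by rw [real_inner_smul_left, hws, mul_zero]
  have h4 : ‖q‖ ^ 2 = ∑ s, d s ^ 2 := by
    rw [← real_inner_self_eq_norm_sq, hq, h.orthonormal.inner_sum]
    simp [sq]
  have h5 : ‖v‖ ^ 2 = ‖q‖ ^ 2 + ‖w‖ ^ 2 := by
    rw [hvqw, norm_add_sq_real, h3]; ring
  have h6 : inner ℝ (sampleCovOp x v) v =
      inner ℝ (sampleCovOp x q) q + inner ℝ (sampleCovOp x w) w := by
    rw [hvqw, sampleCovOp_add, inner_add_left, inner_add_right, inner_add_right, h2,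
      sampleCovOp_symm x w q, h2]
    ring
  have h7 : ∑ s, lamHat s * d s ^ 2 ≤ lamHat r * ∑ s, d s ^ 2 := by
    rw [Finset.mul_sum]
    refine Finset.sum_le_sum fun s _ => ?_
    rcases lt_or_ge s r with hs | hs
    · simp [hd, hv s hs]
    · exact mul_le_mul_of_nonneg_right (h.antitone hs) (sq_nonneg _)
  rw [h6, h1, h5, h4]
  linarith [h.leading w hws r]

lemma IsLeadingEigensystem.le_inner_self (h : IsLeadingEigensystem (sampleCovOp x) lamHat phiHat)
    {r : Fin m} {c : Fin m → ℝ} (hc : ∀ s, r < s → c s = 0) :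
    lamHat r * ‖∑ s, c s • phiHat s‖ ^ 2 ≤
      inner ℝ (sampleCovOp x (∑ s, c s • phiHat s)) (∑ s, c s • phiHat s) := by
  have hno : ‖∑ s, c s • phiHat s‖ ^ 2 = ∑ s, c s ^ 2 := by
    rw [← real_inner_self_eq_norm_sq, h.orthonormal.inner_sum]
    simp [sq]
  rw [inner_sampleCovOp_eigen_sum h, hno, Finset.mul_sum]
  refine Finset.sum_le_sum fun s _ => ?_
  rw [h.orthonormal.inner_right_fintype, mul_assoc, ← sq]
  rcases lt_or_ge r s with hs | hs
  · simp [hc s hs]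
  · exact mul_le_mul_of_nonneg_right (h.antitone hs) (sq_nonneg _)

lemma mean_abs_inner_le (hn : 1 ≤ n) (x : Fin n → L2I) (f : L2I) :
    (n : ℝ)⁻¹ * ∑ u, |inner ℝ (x u) f| ≤ √(inner ℝ (sampleCovOp x f) f) := by
  have hn' : (0 : ℝ) < n := by exact_mod_cast hn
  refine Real.le_sqrt_of_sq_le ?_
  have h := sq_sum_le_card_mul_sum_sq (s := Finset.univ) (f := fun u => |inner ℝ (x u) f|)
  simp only [Finset.card_univ, Fintype.card_fin, sq_abs] at h
  rw [inner_sampleCovOp, mul_pow]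
  calc ((n : ℝ)⁻¹) ^ 2 * (∑ u, |inner ℝ (x u) f|) ^ 2
      ≤ ((n : ℝ)⁻¹) ^ 2 * (n * ∑ u, inner ℝ (x u) f ^ 2) := by gcongr
    _ = _ := by simp only [sq]; field_simp

end Sample

/-! ### Deterministic perturbation of eigenvalues, eigenfunctions and scores. -/

section Perturbation

variable {T : L2I → L2I} {lam : ℕ → ℝ} {phi : ℕ → L2I}
  {n m : ℕ} {x : Fin n → L2I} {lamHat : Fin m → ℝ} {phiHat : Fin m → L2I} {t : ℝ}

/-- Weyl's inequality by dimension count: some nonzero `v` in the span of `r + 1` population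
eigenfunctions is orthogonal to the first `r` sample ones, and both quadratic forms are compared at
`v`. -/
lemma eigenvalue_le_add (hT : IsSpectralDecomposition T lam phi)
    (hS : IsLeadingEigensystem (sampleCovOp x) lamHat phiHat)
    (hD : ∀ f g, |inner ℝ (sampleCovOp x f) g - inner ℝ (T f) g| ≤ t * ‖f‖ * ‖g‖) (r : Fin m) :
    lam r ≤ lamHat r + t := by
  obtain ⟨c, hc0, hc⟩ := exists_ne_zero_sum_smul_orthogonal
    (fun a : Fin (r.val + 1) => phi a) (fun s : Fin r.val => phiHat ⟨s, s.2.trans r.2⟩)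
  set v := ∑ a, c a • phi a with hv
  have ho : Orthonormal ℝ (fun a : Fin (r.val + 1) => phi a) :=
    hT.orthonormal.comp _ Fin.val_injective
  have hv0 : 0 < ‖v‖ := by
    rw [norm_pos_iff]
    intro h0
    refine hc0 (funext fun a => ?_)
    have := ho.inner_right_fintype c a
    rw [← hv, h0, inner_zero_right] at this
    exact this.symm
  have h1 : lam r * ‖v‖ ^ 2 ≤ inner ℝ (T v) v := hT.le_inner_self c
  have h2 := hS.inner_self_le (r := r) (v := v) fun s hs => hc ⟨s, hs⟩
  have h3 := (abs_le.1 (hD v v)).1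
  have h4 : lam r * ‖v‖ ^ 2 ≤ (lamHat r + t) * ‖v‖ ^ 2 := by nlinarith
  exact le_of_mul_le_mul_right h4 (by positivity)

/-- The same argument with roles exchanged. As the `phi` need not be complete, the upper bound for
the form of `T` uses Bessel's inequality, whence `0 ≤ lam r`. -/
lemma sample_eigenvalue_le_add (hT : IsSpectralDecomposition T lam phi)
    (hS : IsLeadingEigensystem (sampleCovOp x) lamHat phiHat)
    (hD : ∀ f g, |inner ℝ (sampleCovOp x f) g - inner ℝ (T f) g| ≤ t * ‖f‖ * ‖g‖) (r : Fin m)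
    (hr : 0 ≤ lam r) : lamHat r ≤ lam r + t := by
  obtain ⟨c, hc0, hc⟩ := exists_ne_zero_sum_smul_orthogonal
    (fun a : Fin (r.val + 1) => phiHat (Fin.castLE r.2 a)) (fun s : Fin r.val => phi s)
  set v := ∑ a, c a • phiHat (Fin.castLE r.2 a) with hv
  have ho : Orthonormal ℝ (fun a : Fin (r.val + 1) => phiHat (Fin.castLE r.2 a)) :=
    hS.orthonormal.comp _ (Fin.castLE_injective _)
  have hv0 : 0 < ‖v‖ := by
    rw [norm_pos_iff]
    intro h0
    refine hc0 (funext fun a => ?_)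
    have := ho.inner_right_fintype c a
    rw [← hv, h0, inner_zero_right] at this
    exact this.symm
  set c' : Fin m → ℝ := fun s => if h : s.val < r.val + 1 then c ⟨s, h⟩ else 0 with hc'
  have hvc : v = ∑ s, c' s • phiHat s := by
    rw [hv]
    refine Finset.sum_of_injOn (Fin.castLE r.2) (Fin.castLE_injective _).injOn (by simp) ?_ ?_
    · intro s _ hs
      have : ¬ s.val < r.val + 1 := by
        intro h
        exact hs ⟨⟨s, h⟩, by simp, rfl⟩
      rw [show c' s = 0 from dif_neg this, zero_smul]
    · intro a _
      have : (Fin.castLE r.2 a).val < r.val + 1 := a.2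
      simp only [hc', this, dif_pos]
      rfl
  have h1 := hS.le_inner_self (r := r) (c := c') fun s hs => by
    have : ¬ s.val < r.val + 1 := by have : r.val < s.val := hs; omega
    exact dif_neg this
  rw [← hvc] at h1
  have h2 := hT.inner_self_le hr (v := v) fun a ha => hc ⟨a, ha⟩
  have h3 := (abs_le.1 (hD v v)).2
  have h4 : lamHat r * ‖v‖ ^ 2 ≤ (lam r + t) * ‖v‖ ^ 2 := by nlinarith
  exact le_of_mul_le_mul_right h4 (by positivity)

/-- If the spectrum of `T` apart from `lam r` stays at a distance `γ` from an approximate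
eigenvalue `μ`, an approximate eigenvector is close to `phi r`. -/
lemma sq_mul_one_sub_sq_inner_le (hT : IsSpectralDecomposition T lam phi) {f : L2I} (hf : ‖f‖ = 1)
    {μ γ : ℝ} {r : ℕ} (hγ : 0 ≤ γ) (hμ : γ ≤ μ) (hgap : ∀ a, a ≠ r → γ ≤ |lam a - μ|)
    (hres : ‖μ • f - T f‖ ≤ t) : γ ^ 2 * (1 - inner ℝ (phi r) f ^ 2) ≤ t ^ 2 := by
  obtain ⟨h1, h2⟩ := hasSum_sq_inner_le hT.orthonormal f
  rw [hf, one_pow] at h2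
  have hTT : HasSum (fun a => lam a ^ 2 * inner ℝ (phi a) f ^ 2) (‖T f‖ ^ 2) := by
    have := hT.hasSum_inner f (T f)
    rw [real_inner_self_eq_norm_sq] at this
    convert this using 2 with a
    rw [real_inner_comm (T f), hT.inner_eigen]
    ring
  have hTf := (hT.hasSum_inner f f).mul_left (-2 * μ)
  have hw : ‖μ • f - T f‖ ^ 2 = μ ^ 2 + (‖T f‖ ^ 2 + -2 * μ * inner ℝ (T f) f) := by
    rw [norm_sub_sq_real, norm_smul, hf, real_inner_smul_left, real_inner_comm, Real.norm_eq_abs,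
      mul_one, sq_abs]
    ring
  -- Termwise, `(λₐ - μ)² ≥ γ²` for `a ≠ r` reads `λₐ² - 2μλₐ ≥ γ² - μ²`. On the complement of the
  -- span of the `phi` the residual is `μ f`, which is where `γ ≤ μ` is needed.
  have hlow : HasSum (fun a => (γ ^ 2 - μ ^ 2) * inner ℝ (phi a) f ^ 2 -
      (if a = r then γ ^ 2 * inner ℝ (phi r) f ^ 2 else 0))
      ((γ ^ 2 - μ ^ 2) * (∑' a, inner ℝ (phi a) f ^ 2) - γ ^ 2 * inner ℝ (phi r) f ^ 2) :=
    (h1.hasSum.mul_left _).sub (hasSum_ite_eq r _)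
  have hle := hasSum_le (fun a => ?_) hlow (hTT.add hTf)
  · have h3 : ‖μ • f - T f‖ ^ 2 ≤ t ^ 2 := by gcongr
    have h4 : 0 ≤ μ ^ 2 - γ ^ 2 := by nlinarith
    nlinarith [mul_le_mul_of_nonneg_left h2 h4]
  · split_ifs with ha
    · subst ha
      nlinarith [mul_nonneg (sq_nonneg (lam a - μ)) (sq_nonneg (inner ℝ (phi a) f))]
    · have h5 : γ ^ 2 ≤ (lam a - μ) ^ 2 := by
        rw [← sq_abs (lam a - μ)]
        have := hgap a ha
        gcongr
      nlinarith [mul_le_mul_of_nonneg_right h5 (sq_nonneg (inner ℝ (phi a) f))]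

/-- The sample eigenvalue moves by at most `γ / 2`, so half the gap survives around it. With `c` the
nonnegative inner product, `2(1 - c) ≤ 2(1 - c²) ≤ 8 t² / γ²`, and `√8 ≤ 3`. -/
lemma norm_sample_eigenvector_sub_le (hT : IsSpectralDecomposition T lam phi)
    (hS : IsLeadingEigensystem (sampleCovOp x) lamHat phiHat)
    (hD : ∀ f g, |inner ℝ (sampleCovOp x f) g - inner ℝ (T f) g| ≤ t * ‖f‖ * ‖g‖) (r : Fin m)
    {γ : ℝ} (hγ : 0 < γ) (hγr : γ ≤ lam r) (hgap : ∀ a : ℕ, a ≠ r → γ ≤ |lam a - lam r|)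
    (ht : 0 ≤ t) (htγ : t ≤ γ / 2) (hsign : 0 ≤ inner ℝ (phiHat r) (phi r)) :
    ‖phiHat r - phi r‖ ≤ 3 * t / γ := by
  have e1 := eigenvalue_le_add hT hS hD r
  have e2 := sample_eigenvalue_le_add hT hS hD r (by linarith)
  have hf : ‖phiHat r‖ = 1 := hS.orthonormal.1 r
  have hg : ‖phi r‖ = 1 := hT.orthonormal.1 r
  have hres : ‖lamHat r • phiHat r - T (phiHat r)‖ ≤ t := by
    rw [← hS.eigen r]
    -- Testing the form bound against `w` itself turns it into the norm bound `‖w‖ ≤ t`.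
    set w := sampleCovOp x (phiHat r) - T (phiHat r) with hw
    have h1 := (abs_le.1 (hD (phiHat r) w)).2
    rw [← inner_sub_left, ← hw, real_inner_self_eq_norm_sq, hf, mul_one, sq] at h1
    rcases (norm_nonneg w).eq_or_lt with h0 | h0
    · rw [← h0]; exact ht
    · exact le_of_mul_le_mul_right h1 h0
  have h2 := sq_mul_one_sub_sq_inner_le hT (t := t) (r := r) hf (μ := lamHat r) (γ := γ / 2)
    (by positivity) (by linarith) (fun a ha => by
      have h3 := hgap a ha
      have h4 : |lam a - lam r| ≤ |lam a - lamHat r| + |lamHat r - lam r| := abs_sub_le _ _ _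
      have h5 : |lamHat r - lam r| ≤ t := abs_le.2 ⟨by linarith, by linarith⟩
      linarith) hres
  rw [real_inner_comm] at h2
  set c : ℝ := inner ℝ (phiHat r) (phi r) with hc
  have hc1 : c ≤ 1 := by
    have := real_inner_le_norm (phiHat r) (phi r)
    rwa [hf, hg, mul_one] at this
  have h3 : ‖phiHat r - phi r‖ ^ 2 = 2 * (1 - c) := by
    rw [norm_sub_sq_real, hf, hg]; ring
  refine abs_le_of_sq_le_sq' ?_ (by positivity) |>.2
  rw [h3, div_pow, le_div_iff₀ (by positivity)]
  have h6 : 1 - c ≤ 1 - c ^ 2 := by nlinarith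
  nlinarith [mul_le_mul_of_nonneg_left h6 (sq_nonneg γ), sq_nonneg t]

/-- The score error splits into a normalization error, tested against `phiHat r`, where the sample
form equals `lamHat r`, and an eigenfunction error, where the sample form is at most `lam 0 + t`
times the squared norm. -/
lemma mean_abs_score_sub_le (hn : 1 ≤ n) (hT : IsSpectralDecomposition T lam phi)
    (hS : IsLeadingEigensystem (sampleCovOp x) lamHat phiHat)
    (hD : ∀ f g, |inner ℝ (sampleCovOp x f) g - inner ℝ (T f) g| ≤ t * ‖f‖ * ‖g‖) (r : Fin m)
    {γ : ℝ} (hγ : 0 < γ) (hγr : γ ≤ lam r) (hgap : ∀ a : ℕ, a ≠ r → γ ≤ |lam a - lam r|)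
    (ht : 0 ≤ t) (htγ : t ≤ γ / 2) (hsign : 0 ≤ inner ℝ (phiHat r) (phi r)) :
    (n : ℝ)⁻¹ * ∑ u, |score (lamHat r) (phiHat r) (x u) - score (lam r) (phi r) (x u)| ≤
      t / lam r + (√(lam r))⁻¹ * (√(lam 0 + t) * (3 * t / γ)) := by
  have e1 := eigenvalue_le_add hT hS hD r
  have e2 := sample_eigenvalue_le_add hT hS hD r (by linarith)
  have hn' : (0 : ℝ) < n := by exact_mod_cast hn
  have hl : 0 < lam r := by linarith
  have hlh : 0 < lamHat r := by linarith
  have hs : 0 < √(lam r) := Real.sqrt_pos.2 hl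
  have hsh : 0 < √(lamHat r) := Real.sqrt_pos.2 hlh
  have hl0 : lam r ≤ lam 0 := hT.antitone (Nat.zero_le _)
  have hnorm := norm_sample_eigenvector_sub_le hT hS hD r hγ hγr hgap ht htγ hsign
  have h1 : (n : ℝ)⁻¹ * ∑ u, |inner ℝ (x u) (phiHat r)| ≤ √(lamHat r) := by
    refine (mean_abs_inner_le hn x _).trans (le_of_eq ?_)
    rw [hS.eigen, real_inner_smul_left, real_inner_self_eq_norm_sq, hS.orthonormal.1]
    simp
  have h2 : (n : ℝ)⁻¹ * ∑ u, |inner ℝ (x u) (phiHat r - phi r)| ≤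
      √(lam 0 + t) * (3 * t / γ) := by
    refine (mean_abs_inner_le hn x _).trans ?_
    set v := phiHat r - phi r
    have h3 := (abs_le.1 (hD v v)).2
    have h4 := hT.inner_self_le (r := 0) (by linarith) (v := v) (by simp)
    have h5 : inner ℝ (sampleCovOp x v) v ≤ (lam 0 + t) * ‖v‖ ^ 2 := by nlinarith
    refine (Real.sqrt_le_sqrt h5).trans ?_
    rw [Real.sqrt_mul (by linarith), Real.sqrt_sq (norm_nonneg _)]
    gcongr
  have hcoef : |(√(lamHat r))⁻¹ - (√(lam r))⁻¹| * √(lamHat r) ≤ t / lam r := by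
    have h6 : (√(lamHat r))⁻¹ - (√(lam r))⁻¹ =
        (lam r - lamHat r) / ((√(lam r) + √(lamHat r)) * (√(lam r) * √(lamHat r))) := by
      rw [eq_div_iff (by positivity)]
      field_simp
      nlinarith [Real.sq_sqrt hl.le, Real.sq_sqrt hlh.le]
    rw [h6, abs_div, abs_of_pos (a := (√(lam r) + √(lamHat r)) * (√(lam r) * √(lamHat r)))
      (by positivity)]
    have h7 : |lam r - lamHat r| ≤ t := abs_le.2 ⟨by linarith, by linarith⟩
    calc _ = |lam r - lamHat r| / ((√(lam r) + √(lamHat r)) * √(lam r)) := by field_simp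
      _ ≤ t / lam r := by
        gcongr
        nlinarith [Real.sq_sqrt hl.le, mul_pos hs hsh]
  have hterm : ∀ u, |score (lamHat r) (phiHat r) (x u) - score (lam r) (phi r) (x u)| ≤
      |(√(lamHat r))⁻¹ - (√(lam r))⁻¹| * |inner ℝ (x u) (phiHat r)| +
        (√(lam r))⁻¹ * |inner ℝ (x u) (phiHat r - phi r)| := by
    intro u
    have : score (lamHat r) (phiHat r) (x u) - score (lam r) (phi r) (x u) =
      ((√(lamHat r))⁻¹ - (√(lam r))⁻¹) * inner ℝ (x u) (phiHat r) +
        (√(lam r))⁻¹ * inner ℝ (x u) (phiHat r - phi r) := by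
      rw [score, score, inner_sub_right]; ring
    rw [this]
    refine (abs_add_le _ _).trans (le_of_eq ?_)
    rw [abs_mul, abs_mul, abs_of_pos (inv_pos.2 hs)]
  calc _ ≤ (n : ℝ)⁻¹ * ∑ u, (|(√(lamHat r))⁻¹ - (√(lam r))⁻¹| * |inner ℝ (x u) (phiHat r)| +
        (√(lam r))⁻¹ * |inner ℝ (x u) (phiHat r - phi r)|) := by
        gcongr with u _
        exact hterm u
    _ = |(√(lamHat r))⁻¹ - (√(lam r))⁻¹| * ((n : ℝ)⁻¹ * ∑ u, |inner ℝ (x u) (phiHat r)|) +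
        (√(lam r))⁻¹ * ((n : ℝ)⁻¹ * ∑ u, |inner ℝ (x u) (phiHat r - phi r)|) := by
        rw [Finset.sum_add_distrib, ← Finset.mul_sum, ← Finset.mul_sum]; ring
    _ ≤ |(√(lamHat r))⁻¹ - (√(lam r))⁻¹| * √(lamHat r) +
        (√(lam r))⁻¹ * (√(lam 0 + t) * (3 * t / γ)) := by gcongr
    _ ≤ _ := by gcongr

end Perturbation

/-! ### Concentration of the sample covariance operator in Hilbert–Schmidt norm. -/

instance instSecondCountableTopologyL2I : SecondCountableTopology L2I :=
  haveI : Fact ((2 : ℝ≥0∞) ≠ ⊤) := ⟨ENNReal.ofNat_ne_top⟩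
  inferInstance

section Span

variable {E : Type*} [NormedAddCommGroup E] [InnerProductSpace ℝ E] [CompleteSpace E]

/-- Extend `phi` to a Hilbert basis; the added basis vectors are orthogonal to every `phi r`, so the
coefficients of `x` there vanish. -/
lemma hasSum_inner_smul_of_mem_orthogonal_orthogonal {phi : ℕ → E} (h : Orthonormal ℝ phi) {x : E}
    (hx : ∀ f : E, (∀ r, inner ℝ (phi r) f = 0) → inner ℝ x f = 0) :
    HasSum (fun r => inner ℝ (phi r) x • phi r) x := by
  obtain ⟨w, b, hw, hb⟩ := h.toSubtypeRange.exists_hilbertBasis_extension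
  have hinj := h.linearIndependent.injective
  let g : ℕ → w := fun r => ⟨phi r, hw (Set.mem_range_self r)⟩
  have hg : Function.Injective g := fun a c hac => hinj (congrArg Subtype.val hac)
  have hs := b.hasSum_repr x
  have hs' : HasSum (fun i : w => inner ℝ (i : E) x • (i : E)) x := by
    convert hs using 2 with i
    rw [b.repr_apply_apply, hb]
  refine (hg.hasSum_iff ?_).2 hs'
  intro i hi
  have : inner ℝ x (i : E) = 0 := by
    refine hx _ fun r => ?_
    have hne : g r ≠ i := fun h' => hi ⟨r, h'⟩
    have := b.orthonormal.2 hne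
    rwa [hb] at this
  rw [real_inner_comm, this, zero_smul]

end Span

section Covariance

variable {Ω : Type*} [MeasurableSpace Ω] {P : Measure Ω}
  {Z : Ω → L2I} {lam : ℕ → ℝ} {phi : ℕ → L2I}

lemma integrable_inner_smul (hZ : MemLp Z 2 P) (f : L2I) :
    Integrable (fun ω => (inner ℝ (Z ω) f) • Z ω) P := by
  have hi : Integrable (fun ω => ‖f‖ * ‖Z ω‖ ^ 2) P := hZ.norm.integrable_sq.const_mul _
  have hc : AEStronglyMeasurable (fun ω => inner ℝ (Z ω) f) P :=
    hZ.1.inner aestronglyMeasurable_const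
  have hm : AEStronglyMeasurable (fun ω => (inner ℝ (Z ω) f) • Z ω) P := hc.smul hZ.1
  refine hi.mono hm ?_
  filter_upwards with ω
  have := norm_inner_le_norm (𝕜 := ℝ) (Z ω) f
  calc ‖(inner ℝ (Z ω) f : ℝ) • Z ω‖ = ‖(inner ℝ (Z ω) f : ℝ)‖ * ‖Z ω‖ := norm_smul _ _
    _ ≤ ‖Z ω‖ * ‖f‖ * ‖Z ω‖ := mul_le_mul_of_nonneg_right this (norm_nonneg _)
    _ = ‖f‖ * ‖Z ω‖ ^ 2 := by ring
    _ ≤ _ := le_abs_self _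

lemma integrable_inner_mul_inner (hZ : MemLp Z 2 P) (f g : L2I) :
    Integrable (fun ω => inner ℝ (Z ω) f * inner ℝ (Z ω) g) P := by
  have := (innerSL ℝ g).integrable_comp (integrable_inner_smul hZ f)
  simpa only [innerSL_apply_apply, inner_smul_right, real_inner_comm g] using this

lemma inner_covOp (hZ : MemLp Z 2 P) (f g : L2I) :
    inner ℝ (covOp P Z f) g = ∫ ω, inner ℝ (Z ω) f * inner ℝ (Z ω) g ∂P := by
  rw [covOp, real_inner_comm, ← integral_inner (integrable_inner_smul hZ f)]
  simp only [inner_smul_right, real_inner_comm g]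

/-- A random element lies in the closed span of the eigenfunctions of its covariance operator. -/
lemma ae_inner_eq_zero_of_orthogonal (hZ : MemLp Z 2 P)
    (h : IsSpectralDecomposition (covOp P Z) lam phi) :
    ∀ᵐ ω ∂P, ∀ f : L2I, (∀ r, inner ℝ (phi r) f = 0) → inner ℝ (Z ω) f = 0 := by
  have h1 : ∀ f : L2I, (∀ r, inner ℝ (phi r) f = 0) → ∀ᵐ ω ∂P, inner ℝ (Z ω) f = 0 := by
    intro f hf
    have h0 : covOp P Z f = 0 := by
      refine (h.hasSum f).unique ?_
      simp [hf, hasSum_zero]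
    have h2 := inner_covOp hZ f f
    rw [h0, inner_zero_left, eq_comm, integral_eq_zero_iff_of_nonneg
      (fun ω => mul_self_nonneg _) (integrable_inner_mul_inner hZ f f)] at h2
    filter_upwards [h2] with ω hω
    exact mul_self_eq_zero.1 hω
  -- For each `f` the exceptional null set may differ; a countable dense subset of the orthogonal
  -- complement makes it uniform.
  let V : Set L2I := {f | ∀ r, inner ℝ (phi r) f = 0}
  have hV0 : (0 : L2I) ∈ V := fun r => inner_zero_right _
  have : Nonempty V := ⟨⟨0, hV0⟩⟩
  have h2 : ∀ᵐ ω ∂P, ∀ k : ℕ, inner ℝ (Z ω) (TopologicalSpace.denseSeq V k : L2I) = 0 :=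
    ae_all_iff.2 fun k => h1 _ (TopologicalSpace.denseSeq V k).2
  filter_upwards [h2] with ω hω f hf
  have hcl : IsClosed {v : V | inner ℝ (Z ω) (v : L2I) = 0} :=
    isClosed_eq (by fun_prop) continuous_const
  have := (TopologicalSpace.denseRange_denseSeq V).induction_on (p := fun v : V =>
    inner ℝ (Z ω) (v : L2I) = 0) ⟨f, hf⟩ hcl hω
  exact this

end Covariance

/-- The coordinates of `z ⊗ z - ∑ᵣ λᵣ φᵣ ⊗ φᵣ` with respect to `φ₀, …, φ_{N-1}`. -/
noncomputable def covCoord (lam : ℕ → ℝ) (phi : ℕ → L2I) (N : ℕ) (z : L2I) :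
    EuclideanSpace ℝ (Fin N × Fin N) :=
  WithLp.toLp 2 fun a => inner ℝ z (phi a.1) * inner ℝ z (phi a.2) -
    if (a.1 : ℕ) = a.2 then lam a.1 else 0

section CovCoord

variable {lam : ℕ → ℝ} {phi : ℕ → L2I}

lemma covCoord_apply (N : ℕ) (z : L2I) (a : Fin N × Fin N) :
    covCoord lam phi N z a = inner ℝ z (phi a.1) * inner ℝ z (phi a.2) -
      if (a.1 : ℕ) = a.2 then lam a.1 else 0 := rfl

lemma continuous_covCoord (N : ℕ) : Continuous (covCoord lam phi N) := by
  unfold covCoord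
  fun_prop

/-- The Hilbert–Schmidt norm of `z ⊗ z` is the sum of squared coefficients, at most `M² S`, and that
of the diagonal part is at most its trace. The bound is uniform in `N`. -/
lemma norm_covCoord_le (hlam : ∀ r, 0 ≤ lam r) {S M : ℝ}
    (hS : ∀ N : ℕ, ∑ r ∈ Finset.range N, lam r ≤ S) (N : ℕ) {z : L2I}
    (hz : ∀ r, inner ℝ z (phi r) ^ 2 ≤ M ^ 2 * lam r) :
    ‖covCoord lam phi N z‖ ≤ 2 * (M ^ 2 + 1) * S := by
  have hS' : ∑ a : Fin N, lam a ≤ S := by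
    rw [Fin.sum_univ_eq_sum_range]; exact hS N
  have hs0 : 0 ≤ ∑ a : Fin N, lam a := Finset.sum_nonneg fun a _ => hlam a
  have hS0 : 0 ≤ S := hs0.trans hS'
  refine abs_le_of_sq_le_sq' ?_ (by positivity) |>.2
  rw [EuclideanSpace.norm_sq_eq]
  have h1 : ∑ a : Fin N, inner ℝ z (phi a) ^ 2 ≤ M ^ 2 * S := by
    refine (Finset.sum_le_sum fun (a : Fin N) _ => hz a).trans ?_
    rw [← Finset.mul_sum]
    gcongr
  have h1' : 0 ≤ ∑ a : Fin N, inner ℝ z (phi a) ^ 2 := Finset.sum_nonneg fun a _ => sq_nonneg _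
  have h2 : ∑ a : Fin N × Fin N, (inner ℝ z (phi a.1) * inner ℝ z (phi a.2)) ^ 2 =
      (∑ a : Fin N, inner ℝ z (phi a) ^ 2) ^ 2 := by
    rw [Fintype.sum_prod_type, sq (∑ a : Fin N, inner ℝ z (phi a) ^ 2), Finset.sum_mul_sum]
    simp only [mul_pow]
  have h3 : ∑ a : Fin N × Fin N, (if (a.1 : ℕ) = a.2 then lam a.1 else 0) ^ 2 ≤ S ^ 2 := by
    have e : ∑ a : Fin N × Fin N, (if (a.1 : ℕ) = a.2 then lam a.1 else 0) ^ 2 =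
        ∑ a : Fin N, lam a ^ 2 := by
      rw [Fintype.sum_prod_type]
      refine Finset.sum_congr rfl fun a _ => ?_
      simp [Fin.val_inj, ite_pow]
    rw [e]
    refine (Finset.sum_sq_le_sq_sum_of_nonneg fun (a : Fin N) _ => hlam a).trans ?_
    gcongr
  calc ∑ a, ‖covCoord lam phi N z a‖ ^ 2
      ≤ ∑ a : Fin N × Fin N, (2 * (inner ℝ z (phi a.1) * inner ℝ z (phi a.2)) ^ 2 +
        2 * (if (a.1 : ℕ) = a.2 then lam a.1 else 0) ^ 2) := by
        refine Finset.sum_le_sum fun a _ => ?_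
        rw [Real.norm_eq_abs, sq_abs, covCoord_apply]
        nlinarith [sq_nonneg (inner ℝ z (phi a.1) * inner ℝ z (phi a.2) +
          if (a.1 : ℕ) = a.2 then lam a.1 else 0)]
    _ ≤ 2 * (M ^ 2 * S) ^ 2 + 2 * S ^ 2 := by
        rw [Finset.sum_add_distrib, ← Finset.mul_sum, ← Finset.mul_sum, h2]
        gcongr
    _ ≤ _ := by
        have : 0 ≤ M ^ 2 * S ^ 2 := by positivity
        have : 0 ≤ M ^ 2 * M ^ 2 * S ^ 2 := by positivity
        nlinarith

lemma norm_sq_sum_covCoord {n : ℕ} (x : Fin n → L2I) (N : ℕ) :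
    ‖∑ u, covCoord lam phi N (x u)‖ ^ 2 = ∑ a ∈ Finset.range N, ∑ b ∈ Finset.range N,
      (∑ u, (inner ℝ (x u) (phi a) * inner ℝ (x u) (phi b) - if a = b then lam a else 0)) ^ 2 := by
  rw [EuclideanSpace.norm_sq_eq, Fintype.sum_prod_type, ← Fin.sum_univ_eq_sum_range (fun a =>
    ∑ b ∈ Finset.range N, (∑ u, (inner ℝ (x u) (phi a) * inner ℝ (x u) (phi b) -
      if a = b then lam a else 0)) ^ 2) N]
  refine Finset.sum_congr rfl fun a _ => ?_
  rw [← Fin.sum_univ_eq_sum_range (fun b => (∑ u, (inner ℝ (x u) (phi a) * inner ℝ (x u) (phi b) -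
      if (a : ℕ) = b then lam a else 0)) ^ 2) N]
  refine Finset.sum_congr rfl fun b _ => ?_
  rw [Real.norm_eq_abs, sq_abs]
  congr 1
  simp [covCoord]

lemma norm_sum_covCoord_mono {n : ℕ} (x : Fin n → L2I) :
    Monotone fun N => ‖∑ u, covCoord lam phi N (x u)‖ := by
  intro N N' h
  refine abs_le_of_sq_le_sq' ?_ (norm_nonneg _) |>.2
  rw [norm_sq_sum_covCoord, norm_sq_sum_covCoord]
  have hsub := Finset.range_mono h
  calc _ ≤ ∑ a ∈ Finset.range N, ∑ b ∈ Finset.range N', (∑ u, (inner ℝ (x u) (phi a) *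
        inner ℝ (x u) (phi b) - if a = b then lam a else 0)) ^ 2 :=
        Finset.sum_le_sum fun a _ =>
          Finset.sum_le_sum_of_subset_of_nonneg hsub fun _ _ _ => sq_nonneg _
    _ ≤ _ := Finset.sum_le_sum_of_subset_of_nonneg hsub fun _ _ _ =>
        Finset.sum_nonneg fun _ _ => sq_nonneg _

/-- The form is the limit of its truncations, each bounded by Cauchy–Schwarz on the double sum and
Bessel's inequality. The expansion `hx` ensures that the coordinates miss no part of the
observations. -/
lemma abs_inner_sampleCovOp_sub_le {T : L2I → L2I} (hT : IsSpectralDecomposition T lam phi)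
    {n : ℕ} (hn : 1 ≤ n) {x : Fin n → L2I}
    (hx : ∀ u, HasSum (fun r => inner ℝ (phi r) (x u) • phi r) (x u)) {t : ℝ} (ht : 0 ≤ t)
    (hb : ∀ N, ‖∑ u, covCoord lam phi N (x u)‖ ≤ n * t) (f g : L2I) :
    |inner ℝ (sampleCovOp x f) g - inner ℝ (T f) g| ≤ t * ‖f‖ * ‖g‖ := by
  have hn' : (0 : ℝ) < n := by exact_mod_cast hn
  have hlim : ∀ u (f : L2I), Filter.Tendsto (fun N => ∑ a ∈ Finset.range N,
      inner ℝ (x u) (phi a) * inner ℝ (phi a) f) Filter.atTop (nhds (inner ℝ (x u) f)) := by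
    intro u f
    have := ((hx u).mapL (innerSL ℝ f)).tendsto_sum_nat
    simp only [innerSL_apply_apply, inner_smul_right] at this
    rw [real_inner_comm] at this
    convert this using 4 with N a
    · exact real_inner_comm _ _
    · exact real_inner_comm _ _
  set d : ℕ → ℕ → ℝ := fun a b =>
    ∑ u, (inner ℝ (x u) (phi a) * inner ℝ (x u) (phi b) - if a = b then lam a else 0) with hd
  set D : ℕ → ℝ := fun N => (n : ℝ)⁻¹ * ∑ a ∈ Finset.range N, ∑ b ∈ Finset.range N,
    d a b * (inner ℝ (phi a) f * inner ℝ (phi b) g) with hD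
  have hDeq : ∀ N, D N = (n : ℝ)⁻¹ * ∑ u, (∑ a ∈ Finset.range N,
      inner ℝ (x u) (phi a) * inner ℝ (phi a) f) * (∑ a ∈ Finset.range N,
      inner ℝ (x u) (phi a) * inner ℝ (phi a) g) -
      ∑ a ∈ Finset.range N, lam a * inner ℝ (phi a) f * inner ℝ (phi a) g := by
    intro N
    have e1 : ∀ a ∈ Finset.range N, ∑ b ∈ Finset.range N,
        d a b * (inner ℝ (phi a) f * inner ℝ (phi b) g) =
        ∑ u, (inner ℝ (x u) (phi a) * inner ℝ (phi a) f) * (∑ b ∈ Finset.range N,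
          inner ℝ (x u) (phi b) * inner ℝ (phi b) g) -
          n * (lam a * inner ℝ (phi a) f * inner ℝ (phi a) g) := by
      intro a ha
      have e2 : ∀ b, d a b = ∑ u, inner ℝ (x u) (phi a) * inner ℝ (x u) (phi b) -
          n * (if a = b then lam a else 0) := by
        intro b
        simp [hd, Finset.sum_sub_distrib]
      simp only [e2, sub_mul, Finset.sum_sub_distrib, Finset.sum_mul, Finset.mul_sum]
      congr 1
      · rw [Finset.sum_comm]
        refine Finset.sum_congr rfl fun u _ => Finset.sum_congr rfl fun b _ => ?_
        ring
      · rw [Finset.sum_eq_single a]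
        · simp; ring
        · intro b _ hb
          simp [hb.symm]
        · exact fun h => absurd ha h
    rw [hD]
    simp only
    rw [Finset.sum_congr rfl e1, Finset.sum_sub_distrib, Finset.sum_comm, ← Finset.mul_sum, mul_sub,
      inv_mul_cancel_left₀ hn'.ne']
    simp only [Finset.sum_mul]
  have hDlim : Filter.Tendsto D Filter.atTop
      (nhds (inner ℝ (sampleCovOp x f) g - inner ℝ (T f) g)) := by
    rw [inner_sampleCovOp, funext hDeq]
    refine Filter.Tendsto.sub ?_ (hT.hasSum_inner f g).tendsto_sum_nat
    exact (tendsto_finsetSum _ fun u _ => (hlim u f).mul (hlim u g)).const_mul _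
  refine le_of_tendsto hDlim.abs (Filter.Eventually.of_forall fun N => ?_)
  have hbes : ∀ f : L2I, ∑ a ∈ Finset.range N, inner ℝ (phi a) f ^ 2 ≤ ‖f‖ ^ 2 := by
    intro f
    have := hT.orthonormal.sum_inner_products_le f (s := Finset.range N)
    simpa only [Real.norm_eq_abs, sq_abs] using this
  have hnn : 0 ≤ ∑ a ∈ Finset.range N, inner ℝ (phi a) f ^ 2 :=
    Finset.sum_nonneg fun _ _ => sq_nonneg _
  have hnn' : 0 ≤ ∑ a ∈ Finset.range N, inner ℝ (phi a) g ^ 2 :=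
    Finset.sum_nonneg fun _ _ => sq_nonneg _
  have hcs : (∑ a ∈ Finset.range N, ∑ b ∈ Finset.range N,
      d a b * (inner ℝ (phi a) f * inner ℝ (phi b) g)) ^ 2 ≤ (n * t * (‖f‖ * ‖g‖)) ^ 2 := by
    rw [← Finset.sum_product' (f := fun a b => d a b * (inner ℝ (phi a) f * inner ℝ (phi b) g))]
    refine (Finset.sum_mul_sq_le_sq_mul_sq _ _ _).trans ?_
    rw [Finset.sum_product' (f := fun a b => d a b ^ 2),
      Finset.sum_product' (f := fun a b => (inner ℝ (phi a) f * inner ℝ (phi b) g) ^ 2),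
      ← norm_sq_sum_covCoord, mul_pow (n * t)]
    simp only [mul_pow, ← Finset.sum_mul_sum]
    have := hb N
    rw [← mul_pow (n : ℝ) t]
    gcongr
    · exact hbes f
    · exact hbes g
  have := abs_le_of_sq_le_sq hcs (by positivity)
  rw [hD]
  simp only
  rw [abs_mul, abs_of_pos (inv_pos.2 hn'), inv_mul_le_iff₀ hn']
  linarith

end CovCoord

section SampleConcentration

variable {Ω : Type*} [MeasurableSpace Ω] {P : Measure Ω} [IsProbabilityMeasure P]
  {Z : Ω → L2I} {lam : ℕ → ℝ} {phi : ℕ → L2I}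

lemma integral_covCoord (hZ : MemLp Z 2 P) (h : IsSpectralDecomposition (covOp P Z) lam phi)
    (N : ℕ) (hi : Integrable (fun ω => covCoord lam phi N (Z ω)) P) :
    ∫ ω, covCoord lam phi N (Z ω) ∂P = 0 := by
  ext a
  have h1 := (EuclideanSpace.proj (𝕜 := ℝ) a :
    EuclideanSpace ℝ (Fin N × Fin N) →L[ℝ] ℝ).integral_comp_comm hi
  simp only [EuclideanSpace.coe_proj] at h1
  rw [← h1]
  simp only [covCoord_apply, PiLp.zero_apply]
  rw [integral_sub (integrable_inner_mul_inner hZ _ _) (integrable_const _), ← inner_covOp hZ,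
    h.inner_eigen, integral_const, probReal_univ, one_smul]
  split_ifs with hab
  · rw [hab, real_inner_self_eq_norm_sq, h.orthonormal.1]; ring
  · rw [h.orthonormal.2 (Ne.symm hab)]; ring

/-- Concentration of the sample covariance operator of a random element with bounded scores. -/
lemma measureReal_sampleCovOp_sub_le {n : ℕ} (hn : 1 ≤ n) (hZ : MemLp Z 2 P)
    (h : IsSpectralDecomposition (covOp P Z) lam phi) (hlam : ∀ r, 0 < lam r) {S M : ℝ}
    (hS : ∀ N : ℕ, ∑ r ∈ Finset.range N, lam r ≤ S)
    (hM : ∀ r, ∀ᵐ ω ∂P, |score (lam r) (phi r) (Z ω)| ≤ M) {Zs : Fin n → Ω → L2I}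
    (hid : ∀ u, IdentDistrib (Zs u) Z P P) (hind : iIndepFun Zs P) {t : ℝ} (ht : 0 < t) :
    P.real {ω | ¬ ∀ f g, |inner ℝ (sampleCovOp (fun u => Zs u ω) f) g -
        inner ℝ (covOp P Z f) g| ≤ t * ‖f‖ * ‖g‖} ≤
      2 * Real.exp (-(n * t ^ 2 / (4 * (2 * (M ^ 2 + 1) * S) ^ 2))) := by
  have hS0 : 0 < S := by
    have := hS 1
    rw [Finset.sum_range_one] at this
    exact (hlam 0).trans_le this
  have hR0 : 0 < 2 * (M ^ 2 + 1) * S := by positivity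
  have hzb : ∀ᵐ ω ∂P, ∀ r, inner ℝ (Z ω) (phi r) ^ 2 ≤ M ^ 2 * lam r := by
    refine ae_all_iff.2 fun r => ?_
    filter_upwards [hM r] with ω hω
    have hs := Real.sqrt_pos.2 (hlam r)
    rw [score, abs_mul, abs_of_pos (inv_pos.2 hs), inv_mul_le_iff₀ hs] at hω
    calc inner ℝ (Z ω) (phi r) ^ 2 = |inner ℝ (Z ω) (phi r)| ^ 2 := (sq_abs _).symm
      _ ≤ (√(lam r) * M) ^ 2 := by gcongr
      _ = M ^ 2 * lam r := by rw [mul_pow, Real.sq_sqrt (hlam r).le]; ring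
  have hsb : ∀ u, ∀ᵐ ω ∂P, ∀ r, inner ℝ (Zs u ω) (phi r) ^ 2 ≤ M ^ 2 * lam r := by
    intro u
    refine (hid u).symm.ae_snd (p := fun z => ∀ r, inner ℝ z (phi r) ^ 2 ≤ M ^ 2 * lam r) ?_ hzb
    refine (isClosed_iInter fun r => ?_ :
      IsClosed (⋂ r, {z : L2I | inner ℝ z (phi r) ^ 2 ≤ M ^ 2 * lam r})).measurableSet.congr ?_
    · exact isClosed_le (by fun_prop) continuous_const
    · ext z; simp
  -- An almost sure property passes to the copies through a measurable set; this intersection is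
  -- uncountable, but it is closed.
  have hso : ∀ u, ∀ᵐ ω ∂P, ∀ f : L2I, (∀ r, inner ℝ (phi r) f = 0) → inner ℝ (Zs u ω) f = 0 := by
    intro u
    refine (hid u).symm.ae_snd (p := fun z => ∀ f : L2I, (∀ r, inner ℝ (phi r) f = 0) →
      inner ℝ z f = 0) ?_ (ae_inner_eq_zero_of_orthogonal hZ h)
    refine (isClosed_iInter fun f => isClosed_iInter fun _ => ?_ :
      IsClosed (⋂ f : L2I, ⋂ (_ : ∀ r, inner ℝ (phi r) f = 0),
        {z : L2I | inner ℝ z f = 0})).measurableSet.congr ?_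
    · exact isClosed_eq (by fun_prop) continuous_const
    · ext z; simp
  -- The events increase with `N` and share one probability bound, so their union inherits it
  -- without a union bound.
  set A : ℕ → Set Ω := fun N => {ω | n * t ≤ ‖∑ u, covCoord lam phi N (Zs u ω)‖} with hA
  have hAmono : Monotone A := fun N N' hN ω hω =>
    le_trans hω (norm_sum_covCoord_mono (fun u => Zs u ω) hN)
  have hAle : ∀ N, P.real (A N) ≤
      2 * Real.exp (-(n * t ^ 2 / (4 * (2 * (M ^ 2 + 1) * S) ^ 2))) := by
    intro N
    have hcm : Measurable (covCoord lam phi N) := (continuous_covCoord N).measurable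
    have hbd : ∀ᵐ ω ∂P, ‖covCoord lam phi N (Z ω)‖ ≤ 2 * (M ^ 2 + 1) * S := by
      filter_upwards [hzb] with ω hω using norm_covCoord_le (fun r => (hlam r).le) hS N hω
    have hi : Integrable (fun ω => covCoord lam phi N (Z ω)) P :=
      Integrable.of_bound ((continuous_covCoord N).comp_aestronglyMeasurable hZ.1) _ hbd
    have := measureReal_norm_sum_ge_le (P := P) (Y := fun u ω => covCoord lam phi N (Zs u ω))
      (hind.comp (fun _ => covCoord lam phi N) fun _ => hcm)
      (fun u => hcm.comp_aemeasurable (hid u).aemeasurable_fst) hR0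
      (fun u => by
        filter_upwards [hsb u] with ω hω using norm_covCoord_le (fun r => (hlam r).le) hS N hω)
      (fun u => by
        have := ((hid u).comp hcm).integral_eq
        simp only [Function.comp_apply] at this
        rw [this, integral_covCoord hZ h N hi]) Finset.univ ht
    simpa using this
  have hsub : ∀ᵐ ω ∂P, ω ∈ {ω | ¬ ∀ f g, |inner ℝ (sampleCovOp (fun u => Zs u ω) f) g -
        inner ℝ (covOp P Z f) g| ≤ t * ‖f‖ * ‖g‖} → ω ∈ ⋃ N, A N := by
    filter_upwards [ae_all_iff.2 hso] with ω hω hbad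
    by_contra hcon
    refine hbad fun f g => ?_
    refine abs_inner_sampleCovOp_sub_le h hn (fun u =>
      hasSum_inner_smul_of_mem_orthogonal_orthogonal h.orthonormal (hω u)) ht.le (fun N => ?_) f g
    by_contra hN
    exact hcon (Set.mem_iUnion.2 ⟨N, (not_le.1 hN).le⟩)
  refine ENNReal.toReal_le_of_le_ofReal (by positivity) ?_
  have hle : P {ω | ¬ ∀ f g, |inner ℝ (sampleCovOp (fun u => Zs u ω) f) g -
        inner ℝ (covOp P Z f) g| ≤ t * ‖f‖ * ‖g‖} ≤ P (⋃ N, A N) := measure_mono_ae hsub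
  refine hle.trans ?_
  rw [hAmono.measure_iUnion]
  refine iSup_le fun N => ?_
  rw [← ofReal_measureReal]
  exact ENNReal.ofReal_le_ofReal (hAle N)

end SampleConcentration

/-! ### Score errors under polynomial eigenvalue decay. -/

section Decay

variable {T : L2I → L2I} {lam : ℕ → ℝ} {phi : ℕ → L2I} {n m : ℕ} {x : Fin n → L2I}
  {lamHat : Fin m → ℝ} {phiHat : Fin m → L2I} {t d₀ d₁ d₂ β : ℝ}

/-- Below `r` the gap after index `r - 1` is used; its lower bound is larger because the exponent is
negative. -/
lemma gap_le_abs_sub (hanti : Antitone lam) (hd₂ : 0 < d₂) (hβ : 1 < β)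
    (hgap : ∀ r : ℕ, d₂⁻¹ * ((r : ℝ) + 1) ^ (-1 - β) ≤ lam r - lam (r + 1)) {a r : ℕ}
    (h : a ≠ r) : d₂⁻¹ * ((r : ℝ) + 1) ^ (-1 - β) ≤ |lam a - lam r| := by
  rcases lt_or_gt_of_ne h with h | h
  · obtain ⟨s, rfl⟩ : ∃ s, r = s + 1 := ⟨r - 1, by omega⟩
    have h1 : lam s ≤ lam a := hanti (by omega)
    have h2 : (((s + 1 : ℕ) : ℝ) + 1) ^ (-1 - β) ≤ ((s : ℝ) + 1) ^ (-1 - β) :=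
      Real.rpow_le_rpow_of_nonpos (by positivity) (by push_cast; linarith) (by linarith)
    have h3 := mul_le_mul_of_nonneg_left h2 (inv_pos.2 hd₂).le
    exact le_trans (by linarith [hgap s]) (le_abs_self _)
  · have h1 : lam a ≤ lam (r + 1) := hanti h
    rw [abs_sub_comm]
    exact le_trans (by linarith [hgap r]) (le_abs_self _)

/-- The normalization `λᵣ ^ (-1/2)` costs the power `β/2` and the inverse gap `1 + β`, giving `1 +
3β/2`. The term `t / lam r` only needs the power `β`. -/
lemma mean_abs_score_sub_le_of_decay (hn : 1 ≤ n) (hT : IsSpectralDecomposition T lam phi)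
    (hd₀ : 0 < d₀) (hd₁ : 0 < d₁) (hd₂ : 0 < d₂) (hβ : 1 < β)
    (hlow : ∀ r : ℕ, d₀ * ((r : ℝ) + 1) ^ (-β) ≤ lam r)
    (hupp : ∀ r : ℕ, lam r ≤ d₁ * ((r : ℝ) + 1) ^ (-β))
    (hgap : ∀ r : ℕ, d₂⁻¹ * ((r : ℝ) + 1) ^ (-1 - β) ≤ lam r - lam (r + 1))
    (hS : IsLeadingEigensystem (sampleCovOp x) lamHat phiHat)
    (hD : ∀ f g, |inner ℝ (sampleCovOp x f) g - inner ℝ (T f) g| ≤ t * ‖f‖ * ‖g‖) (r : Fin m)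
    (ht : 0 ≤ t) (htγ : t ≤ d₂⁻¹ * ((r : ℝ) + 1) ^ (-1 - β) / 2)
    (hsign : 0 ≤ inner ℝ (phiHat r) (phi r)) :
    (n : ℝ)⁻¹ * ∑ u, |score (lamHat r) (phiHat r) (x u) - score (lam r) (phi r) (x u)| ≤
      (d₀⁻¹ + 3 * d₂ * √(2 * d₁) / √d₀) * t * ((r : ℝ) + 1) ^ (1 + 3 * β / 2) := by
  set ρ : ℝ := (r : ℝ) + 1 with hρ
  have hρ1 : 1 ≤ ρ := by rw [hρ]; linarith [Nat.cast_nonneg (α := ℝ) (r : ℕ)]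
  have hρ0 : 0 < ρ := by linarith
  have hpos : ∀ s : ℕ, 0 < lam s := fun s => lt_of_lt_of_le (by positivity) (hlow s)
  have hγr : d₂⁻¹ * ρ ^ (-1 - β) ≤ lam r := by linarith [hgap r, hpos (r + 1)]
  have key := mean_abs_score_sub_le hn hT hS hD r (γ := d₂⁻¹ * ρ ^ (-1 - β)) (by positivity) hγr
    (fun a ha => gap_le_abs_sub hT.antitone hd₂ hβ hgap ha) ht htγ hsign
  have hlam0 : lam 0 ≤ d₁ := by simpa using hupp 0
  have hl0 : lam r ≤ lam 0 := hT.antitone (Nat.zero_le _)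
  have h1 : t / lam r ≤ d₀⁻¹ * t * ρ ^ (1 + 3 * β / 2) := by
    calc t / lam r ≤ t / (d₀ * ρ ^ (-β)) := by
          gcongr
          exact hlow r
      _ = d₀⁻¹ * t * ρ ^ β := by
          rw [Real.rpow_neg hρ0.le]; field_simp
      _ ≤ _ := by
          gcongr
          linarith
  have h2 : (√(lam r))⁻¹ ≤ (√d₀)⁻¹ * ρ ^ (β / 2) := by
    have h3 : √(d₀ * ρ ^ (-β)) = √d₀ * ρ ^ (-(β / 2)) := by
      rw [Real.sqrt_mul hd₀.le, Real.sqrt_eq_rpow (ρ ^ (-β)), ← Real.rpow_mul hρ0.le]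
      ring_nf
    have h4 : (√d₀)⁻¹ * ρ ^ (β / 2) = (√(d₀ * ρ ^ (-β)))⁻¹ := by
      rw [h3, Real.rpow_neg hρ0.le, mul_inv, inv_inv]
    rw [h4]
    gcongr
    exact hlow r
  have h5 : 3 * t / (d₂⁻¹ * ρ ^ (-1 - β)) = 3 * t * d₂ * ρ ^ (1 + β) := by
    rw [show -1 - β = -(1 + β) by ring, Real.rpow_neg hρ0.le]
    field_simp
  have h6 : lam 0 + t ≤ 2 * d₁ := by linarith
  have h7 : ρ ^ (1 + 3 * β / 2) = ρ ^ (β / 2) * ρ ^ (1 + β) := by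
    rw [← Real.rpow_add hρ0]; ring_nf
  calc _ ≤ _ := key
    _ ≤ d₀⁻¹ * t * ρ ^ (1 + 3 * β / 2) +
        ((√d₀)⁻¹ * ρ ^ (β / 2)) * (√(2 * d₁) * (3 * t * d₂ * ρ ^ (1 + β))) := by
        rw [h5]
        gcongr
    _ = _ := by rw [h7]; ring

end Decay

end FPCA

/-! ### Choice of constants and conclusion. -/

theorem theorem8p1 (d₀ d₁ d₂ β α A B Cφ M : ℝ) (Λ : ℝ≥0) (ℓ : ℕ)
    (hd₀ : 0 < d₀) (hd₁ : 0 < d₁) (hd₂ : 0 < d₂) (hβ : 1 < β)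
    (hα₀ : 0 ≤ α) (hα₁ : α < 1 / (2 + 3 * β)) (hA : 0 < A) (hB : 0 < B) (hℓ : 1 ≤ ℓ) :
    ∃ C₁ : ℝ, 0 < C₁ ∧ ∃ K : ℝ, 0 < K ∧
      ∀ (n p m L : ℕ), 1 ≤ n → A * (n : ℝ) ^ α ≤ m → (m : ℝ) ≤ B * (n : ℝ) ^ α →
      ∀ Ψ : ℝ → ℝ, Monotone Ψ → LipschitzWith Λ Ψ → (∀ x, Ψ x ∈ Set.Icc (-1 : ℝ) 1) →
      ∀ {Ω : Type*} [MeasurableSpace Ω] (P : Measure Ω) [IsProbabilityMeasure P]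
        (X : Ω → Fin p → FPCA.L2I) (Xs : Fin n → Ω → Fin p → FPCA.L2I)
        (lam : Fin p → ℕ → ℝ) (phi : Fin p → ℕ → FPCA.L2I)
        (lamHat : Ω → Fin p → Fin m → ℝ) (phiHat : Ω → Fin p → Fin m → FPCA.L2I),
        -- the population: centred, square integrable, with bounded scores
        (∀ i, MemLp (fun ω => X ω i) 2 P) →
        (∀ i, ∫ ω, X ω i ∂P = 0) →
        (∀ i, FPCA.IsSpectralDecomposition (FPCA.covOp P (fun ω => X ω i)) (lam i) (phi i)) →
        FPCA.EigenCondition d₀ d₁ d₂ β Cφ lam phi →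
        (∀ i r, ∀ᵐ ω ∂P, |FPCA.score (lam i r) (phi i r) (X ω i)| ≤ M) →
        -- the independent sample
        (∀ u, IdentDistrib (Xs u) X P P) →
        iIndepFun Xs P →
        -- the estimated eigenpairs, with the signs of the eigenfunctions aligned
        (∀ᵐ ω ∂P, ∀ i, FPCA.IsLeadingEigensystem (FPCA.sampleCovOp (fun u => Xs u ω i))
          (lamHat ω i) (phiHat ω i)) →
        (∀ᵐ ω ∂P, ∀ i (r : Fin m), 0 ≤ inner ℝ (phiHat ω i r) (phi i r)) →
        ∀ δ : ℝ, 0 < δ → δ ≤ C₁ →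
        ∀ (i j : Fin p) (r q : Fin m) (k l : Fin (L + ℓ + 1)),
          P.real {ω | δ ≤
            |FPCA.designEntry ℓ L
                (fun u i r => Ψ (FPCA.score (lamHat ω i r) (phiHat ω i r) (Xs u ω i)))
                i j r q k l -
              FPCA.designEntry ℓ L
                (fun u i (r : Fin m) => Ψ (FPCA.score (lam i r) (phi i r) (Xs u ω i)))
                i j r q k l|} ≤
          K * Real.exp (-C₁ * (n : ℝ) ^ (1 - α * (2 + 3 * β)) *
            ((L + ℓ + 1 : ℕ) : ℝ) ^ (-2 : ℤ) * δ ^ 2) := by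
  have hsum : Summable fun r : ℕ => d₁ * ((r : ℝ) + 1) ^ (-β) := by
    refine Summable.mul_left _ ?_
    have := (summable_nat_add_iff 1).2 (Real.summable_nat_rpow.2 (show -β < -1 by linarith))
    simpa using this
  set S : ℝ := ∑' r : ℕ, d₁ * ((r : ℝ) + 1) ^ (-β) with hSdef
  have hS0 : 0 < S := hsum.tsum_pos (fun r => by positivity) 0 (by simpa using hd₁)
  set R : ℝ := 2 * (M ^ 2 + 1) * S with hR
  have hR0 : 0 < R := by positivity
  -- The added one keeps `c` positive when `Λ = 0`.
  set c : ℝ := 2 * ℓ * 4 ^ ℓ * Λ + 1 with hc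
  have hc0 : 0 < c := by positivity
  set C₂ : ℝ := d₀⁻¹ + 3 * d₂ * √(2 * d₁) / √d₀ with hC₂
  have hC₂0 : 0 < C₂ := by positivity
  set e : ℝ := 1 + 3 * β / 2 with he
  have he0 : 0 < e := by positivity
  set C₃ : ℝ := C₂ * B ^ e with hC₃
  have hC₃0 : 0 < C₃ := by positivity
  -- The first entry of the minimum makes `t` at most half of every relevant gap; the second is the
  -- constant in the exponent. The factor 4 counts two bad events with prefactor 2 each.
  refine ⟨min (2 * c * C₂ / d₂) (1 / (64 * c ^ 2 * C₃ ^ 2 * R ^ 2)), by positivity, 4, by norm_num,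
    ?_⟩
  intro n p m L hn _ hmB Ψ _ hΨ hΨI Ω _ P _ X Xs lam phi lamHat phiHat hX _ hT hE hM hid hind
    hS hsign δ hδ hδC i j r q k l
  have hn0 : (0 : ℝ) < n := by exact_mod_cast hn
  set kn : ℝ := ((L + ℓ + 1 : ℕ) : ℝ) with hkn
  have hkn1 : (L : ℝ) + 1 ≤ kn := by
    rw [hkn]; push_cast; linarith [Nat.cast_nonneg (α := ℝ) ℓ]
  have hkn0 : 1 ≤ kn := by linarith [Nat.cast_nonneg (α := ℝ) L]
  have hkn0' : 0 < kn := by linarith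
  set N : ℝ := (n : ℝ) ^ (α * e) with hN
  have hN0 : 0 < N := by positivity
  set ε : ℝ := δ / (2 * c * kn) with hε
  have hε0 : 0 < ε := by positivity
  have hεC : ε ≤ C₂ / d₂ := by
    have h1 : δ ≤ 2 * c * C₂ / d₂ := hδC.trans (min_le_left _ _)
    rw [hε, div_le_div_iff₀ (by positivity) hd₂]
    rw [le_div_iff₀ hd₂] at h1
    have : 2 * c * C₂ * 1 ≤ 2 * c * C₂ * kn := by gcongr
    linarith
  -- Chosen so that the mean score error is at most `ε / 2`; two errors strictly below `ε` move the
  -- design entry by less than `c * kn * 2 * ε = δ`.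
  set t : ℝ := ε / (2 * C₃ * N) with ht
  have ht0 : 0 < t := by positivity
  have hpow : ∀ r : Fin m, ((r : ℝ) + 1) ^ e ≤ B ^ e * N := by
    intro r
    have h1 : ((r : ℝ) + 1) ≤ B * (n : ℝ) ^ α := by
      refine le_trans ?_ hmB
      exact_mod_cast r.2
    calc ((r : ℝ) + 1) ^ e ≤ (B * (n : ℝ) ^ α) ^ e := by gcongr
      _ = B ^ e * N := by
        rw [Real.mul_rpow hB.le (by positivity), ← Real.rpow_mul hn0.le]
  have hlam0 : ∀ i r, 0 < lam i r := fun i r => lt_of_lt_of_le (by positivity) (hE.lower i r)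
  have hlamS : ∀ i (N : ℕ), ∑ r ∈ Finset.range N, lam i r ≤ S := fun i N =>
    (Finset.sum_le_sum fun r _ => hE.upper i r).trans
      (hsum.sum_le_tsum _ fun r _ => by positivity)
  set bad : Fin p → Set Ω := fun i => {ω | ¬ ∀ f g,
    |inner ℝ (FPCA.sampleCovOp (fun u => Xs u ω i) f) g -
      inner ℝ (FPCA.covOp P (fun ω => X ω i) f) g| ≤ t * ‖f‖ * ‖g‖} with hbad
  have hprob : ∀ i, P.real (bad i) ≤ 2 * Real.exp (-(n * t ^ 2 / (4 * R ^ 2))) := fun i =>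
    FPCA.measureReal_sampleCovOp_sub_le hn (hX i) (hT i) (hlam0 i) (hlamS i) (hM i)
      (Zs := fun u ω => Xs u ω i)
      (fun u => (hid u).comp (measurable_pi_apply i))
      (hind.comp (fun _ x => x i) fun _ => measurable_pi_apply i) ht0
  have hscore : ∀ ω, (∀ i, FPCA.IsLeadingEigensystem (FPCA.sampleCovOp (fun u => Xs u ω i))
      (lamHat ω i) (phiHat ω i)) → (∀ i (r : Fin m), 0 ≤ inner ℝ (phiHat ω i r) (phi i r)) →
      ∀ (i : Fin p) (r : Fin m), ω ∉ bad i → (n : ℝ)⁻¹ * ∑ u,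
        |FPCA.score (lamHat ω i r) (phiHat ω i r) (Xs u ω i) -
          FPCA.score (lam i r) (phi i r) (Xs u ω i)| < ε := by
    intro ω h1 h2 i r h3
    have hD := not_not.1 h3
    have hρ1 : (1 : ℝ) ≤ (r : ℝ) + 1 := by linarith [Nat.cast_nonneg (α := ℝ) (r : ℕ)]
    have htγ : t ≤ d₂⁻¹ * ((r : ℝ) + 1) ^ (-1 - β) / 2 := by
      have h4 : ((r : ℝ) + 1) ^ (1 + β) ≤ B ^ e * N :=
        (Real.rpow_le_rpow_of_exponent_le hρ1 (by rw [he]; linarith)).trans (hpow r)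
      have h5 : d₂⁻¹ * ((r : ℝ) + 1) ^ (-1 - β) / 2 = 1 / (2 * d₂ * ((r : ℝ) + 1) ^ (1 + β)) := by
        rw [show -1 - β = -(1 + β) by ring, Real.rpow_neg (by positivity)]
        field_simp
      rw [h5]
      calc t ≤ (C₂ / d₂) / (2 * C₃ * N) := by rw [ht]; gcongr
        _ = 1 / (2 * d₂ * (B ^ e * N)) := by rw [hC₃]; field_simp
        _ ≤ _ := by gcongr
    refine (FPCA.mean_abs_score_sub_le_of_decay hn (hT i) hd₀ hd₁ hd₂ hβ (hE.lower i) (hE.upper i)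
      (hE.gap i) (h1 i) hD r ht0.le htγ (h2 i r)).trans_lt ?_
    calc C₂ * t * ((r : ℝ) + 1) ^ e ≤ C₂ * t * (B ^ e * N) := by
          gcongr
          exact hpow r
      _ = ε / 2 := by rw [ht, hC₃]; field_simp
      _ < ε := half_lt_self hε0
  set D : Set Ω := {ω | δ ≤
            |FPCA.designEntry ℓ L
                (fun u i r => Ψ (FPCA.score (lamHat ω i r) (phiHat ω i r) (Xs u ω i)))
                i j r q k l -
              FPCA.designEntry ℓ L
                (fun u i (r : Fin m) => Ψ (FPCA.score (lam i r) (phi i r) (Xs u ω i)))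
                i j r q k l|} with hDdef
  have hsub : ∀ᵐ ω ∂P, ω ∈ D → ω ∈ bad i ∪ bad j := by
    filter_upwards [hS, hsign] with ω h1 h2 h3
    by_contra hcon
    rw [Set.mem_union, not_or] at hcon
    have h4 := hscore ω h1 h2 i r hcon.1
    have h5 := hscore ω h1 h2 j q hcon.2
    have h6 := FPCA.abs_designEntry_sub_le hℓ hn hΨ hΨI
      (fun u i r => FPCA.score (lamHat ω i r) (phiHat ω i r) (Xs u ω i))
      (fun u i r => FPCA.score (lam i r) (phi i r) (Xs u ω i)) i j r q k l
    have h7 : δ ≤ _ := h3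
    have h8 : δ < δ := by
      calc δ ≤ _ := h7
        _ ≤ _ := h6
        _ ≤ c * kn * ((n : ℝ)⁻¹ * ∑ u, |FPCA.score (lamHat ω i r) (phiHat ω i r) (Xs u ω i) -
              FPCA.score (lam i r) (phi i r) (Xs u ω i)| +
            (n : ℝ)⁻¹ * ∑ u, |FPCA.score (lamHat ω j q) (phiHat ω j q) (Xs u ω j) -
              FPCA.score (lam j q) (phi j q) (Xs u ω j)|) := by
            gcongr
            rw [hc]; linarith
        _ < c * kn * (ε + ε) := by gcongr
        _ = δ := by rw [hε]; field_simp; ring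
    exact lt_irrefl _ h8
  have hle : P D ≤ P (bad i ∪ bad j) := measure_mono_ae hsub
  have hle' : P.real D ≤ P.real (bad i) + P.real (bad j) :=
    (ENNReal.toReal_mono (measure_ne_top _ _) hle).trans (measureReal_union_le _ _)
  have hexp : Real.exp (-(n * t ^ 2 / (4 * R ^ 2))) ≤
      Real.exp (-(min (2 * c * C₂ / d₂) (1 / (64 * c ^ 2 * C₃ ^ 2 * R ^ 2))) *
        (n : ℝ) ^ (1 - α * (2 + 3 * β)) * kn ^ (-2 : ℤ) * δ ^ 2) := by
    -- Since `2e = 2 + 3β`, the loss `N²` in `n t²` is exactly `n ^ (α (2 + 3β))`.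
    have h1 : (n : ℝ) ^ (1 - α * (2 + 3 * β)) = n / N ^ 2 := by
      rw [Real.rpow_sub hn0, Real.rpow_one, hN, ← Real.rpow_natCast, ← Real.rpow_mul hn0.le]
      congr 2
      rw [he]; push_cast; ring
    have h2 : n * t ^ 2 / (4 * R ^ 2) = (1 / (64 * c ^ 2 * C₃ ^ 2 * R ^ 2)) *
        (n : ℝ) ^ (1 - α * (2 + 3 * β)) * kn ^ (-2 : ℤ) * δ ^ 2 := by
      rw [h1, ht, hε, zpow_neg]
      norm_cast
      field_simp
      ring
    rw [h2, Real.exp_le_exp, neg_mul, neg_mul, neg_mul, neg_le_neg_iff]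
    gcongr
    exact min_le_right _ _
  linarith [hprob i, hprob j]
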